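/- Let $G$ be a tubular group, that is, the fundamental group of a finite connected graph of groups all of whose vertex groups are isomorphic to $\mathbf{Z}^2$ and all of whose edge groups are isomorphic to $\mathbf{Z}$. Assume that $G$ is undistorted: every vertex group, with a word metric, is quasiisometrically embedded in $G$ by the inclusion. Suppose that some vertex group $G_v$ has (at least) three commensurability classes of incident edge groups, that is, among the images in $G_v$ of the edge groups of edges with an end at $v$ (a loop at $v$ contributes the images under both of its edge maps) there are three that are pairwise non-commensurable in $G_v$. Then there is a $2$-dimensional richly branching flat $R$ with a quasiisometric embedding of $R$ into $G$, where $G$ carries a word metric with respect to a finite generating set. Here an $n$-dimensional richly branching flat ($n$-RBF, $n\ge 2$) is a space obtained as follows. Take a copy $B$ of the Euclidean space $\mathbf{R}^n$, pairwise linearly independent vectors $v_0,\dots,v_n\in B$, and coarsely dense subsets $P_0,\dots,P_n\subset\mathbf{R}$ (each $P_i$ is at finite Hausdorff distance from $\mathbf{R}$). For every $i$ and every $p\in P_i$, glue a copy of the half-flat $\mathbf{R}^{n-1}\times[0,\infty)$ to $B$, isometrically along its boundary, along the affine hyperplane $p v_i+v_i^\perp$. The resulting space has the path metric. -/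

import Mathlib

universe u₁ u₂ u₃ u₄

/-! ### Graphs of groups -/

/-- A graph of groups on the graph with vertex set `V` and (unoriented) edge set `E`. Every edge `e`
has two ends, `(e, false)` and `(e, true)`, lying at the vertices `endpoint e false` and
`endpoint e true` (loops and multiple edges are allowed), and for both ends there is an injective
homomorphism from the edge group into the vertex group at that end. -/
structure GraphOfGroups (V : Type u₁) (E : Type u₂) where
  endpoint : E → Bool → V
  vertexGroup : V → Type u₃
  edgeGroup : E → Type u₄
  [vertexGroupGroup : ∀ v, Group (vertexGroup v)]
  [edgeGroupGroup : ∀ e, Group (edgeGroup e)]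
  incl : ∀ (e : E) (b : Bool), edgeGroup e →* vertexGroup (endpoint e b)
  incl_injective : ∀ (e : E) (b : Bool), Function.Injective (incl e b)

namespace GraphOfGroups

attribute [instance] GraphOfGroups.vertexGroupGroup GraphOfGroups.edgeGroupGroup

variable {V : Type u₁} {E : Type u₂} (𝒢 : GraphOfGroups.{u₁, u₂, u₃, u₄} V E)

/-- `u` and `w` are joined by a path all of whose edges lie in `T`. -/
def Joined (T : Set E) (u w : V) : Prop :=
  Relation.EqvGen (fun x y => ∃ e ∈ T, 𝒢.endpoint e false = x ∧ 𝒢.endpoint e true = y) u w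

/-- The edges in `T`, with all the vertices, form a tree: they connect all the vertices,
and there is no cycle, that is, no edge in `T` has its ends joined by the other edges in `T`. -/
structure IsSpanningTree (T : Set E) : Prop where
  connected : ∀ u w : V, 𝒢.Joined T u w
  acyclic : ∀ e ∈ T, ¬ 𝒢.Joined (T \ {e}) (𝒢.endpoint e false) (𝒢.endpoint e true)

/-- The free product of all the vertex groups and of the free group on the stable letters `t_e`,
one for each edge. -/
abbrev FreeProd : Type (max u₁ u₂ u₃) :=
  Monoid.Coprod (Monoid.CoprodI 𝒢.vertexGroup) (FreeGroup E)

/-- A vertex group in the free product. -/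
def ofVertex (v : V) : 𝒢.vertexGroup v →* 𝒢.FreeProd :=
  Monoid.Coprod.inl.comp Monoid.CoprodI.of

/-- A stable letter in the free product. -/
def stable (e : E) : 𝒢.FreeProd := Monoid.Coprod.inr (FreeGroup.of e)

/-- The relators of the fundamental group: `t_e ι₀(g) t_e⁻¹ = ι₁(g)` for every `g` in the edge
group of `e`, and `t_e = 1` for every `e` in the spanning tree `T`. -/
def relators (T : Set E) : Set 𝒢.FreeProd :=
  {r | ∃ (e : E) (g : 𝒢.edgeGroup e),
      r = 𝒢.stable e * 𝒢.ofVertex _ (𝒢.incl e false g) * (𝒢.stable e)⁻¹ *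
        (𝒢.ofVertex _ (𝒢.incl e true g))⁻¹} ∪
  {r | ∃ e ∈ T, r = 𝒢.stable e}

/-- The fundamental group of a graph of groups, with respect to the spanning tree `T`. -/
abbrev FundamentalGroup (T : Set E) : Type (max u₁ u₂ u₃) :=
  𝒢.FreeProd ⧸ Subgroup.normalClosure (𝒢.relators T)

/-- The canonical homomorphism of a vertex group into the fundamental group. -/
def vertexHom (T : Set E) (v : V) : 𝒢.vertexGroup v →* 𝒢.FundamentalGroup T :=
  (QuotientGroup.mk' (Subgroup.normalClosure (𝒢.relators T))).comp (𝒢.ofVertex v)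

/-- All vertex groups are copies of `ℤ²` and all edge groups are copies of `ℤ`. -/
structure IsTubular : Prop where
  vertex : ∀ v, Nonempty (𝒢.vertexGroup v ≃* Multiplicative (ℤ × ℤ))
  edge : ∀ e, Nonempty (𝒢.edgeGroup e ≃* Multiplicative ℤ)

/-- `𝒢.IsIncidentEdgeGroup v H`: the subgroup `H` of the vertex group at `v` is the image of the
edge group of an edge with an end at `v`. -/
inductive IsIncidentEdgeGroup : (v : V) → Subgroup (𝒢.vertexGroup v) → Prop
  | range (e : E) (b : Bool) : IsIncidentEdgeGroup (𝒢.endpoint e b) (𝒢.incl e b).range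

end GraphOfGroups

/-! ### Word metrics and quasiisometric embeddings -/

/-- The length of a shortest word in `S ∪ S⁻¹` that represents `g`. -/
noncomputable def wordLength {G : Type*} [Group G] (S : Set G) (g : G) : ℕ :=
  sInf {n | ∃ l : List G, l.length = n ∧ (∀ x ∈ l, x ∈ S ∨ x⁻¹ ∈ S) ∧ l.prod = g}

/-- The (left invariant) word metric with respect to `S`. -/
noncomputable def wordDist {G : Type*} [Group G] (S : Set G) (g h : G) : ℝ :=
  wordLength S (g⁻¹ * h)

/-- `S` is a finite generating set of the group `G`. -/
def IsFiniteGenerating {G : Type*} [Group G] (S : Set G) : Prop :=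
  S.Finite ∧ Subgroup.closure S = ⊤

/-- `f` is a quasiisometric embedding for the distance functions `dX` and `dY`. -/
def IsQIEmbedding {X Y : Type*} (dX : X → X → ℝ) (dY : Y → Y → ℝ) (f : X → Y) : Prop :=
  ∃ K C : ℝ, 1 ≤ K ∧ 0 ≤ C ∧ ∀ x y : X,
    dX x y / K - C ≤ dY (f x) (f y) ∧ dY (f x) (f y) ≤ K * dX x y + C

/-- A homomorphism between finitely generated groups is undistorted if it is a quasiisometric
embedding for word metrics (the choice of the finite generating sets does not matter). -/
def IsUndistortedHom {H G : Type*} [Group H] [Group G] (φ : H →* G) : Prop :=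
  ∃ (S : Set H) (S' : Set G), IsFiniteGenerating S ∧ IsFiniteGenerating S' ∧
    IsQIEmbedding (wordDist S) (wordDist S') φ

/-- All vertex groups are undistorted in the fundamental group. -/
def GraphOfGroups.IsUndistorted {V : Type u₁} {E : Type u₂}
    (𝒢 : GraphOfGroups.{u₁, u₂, u₃, u₄} V E) (T : Set E) : Prop :=
  ∀ v, IsUndistortedHom (𝒢.vertexHom T v)

/-! ### Richly branching flats -/

/-- The choices that determine an `n`-dimensional richly branching flat with base flat `ℝⁿ`:
pairwise linearly independent vectors `v₀, …, vₙ`, and coarsely dense sets `P₀, …, Pₙ` of reals. -/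
structure RBFData (n : ℕ) where
  v : Fin (n + 1) → EuclideanSpace ℝ (Fin n)
  indep : Pairwise fun i j => LinearIndependent ℝ ![v i, v j]
  P : Fin (n + 1) → Set ℝ
  dense : ∀ i, ∃ r : ℝ, ∀ t : ℝ, ∃ p ∈ P i, |t - p| ≤ r

namespace RBFData

variable {n : ℕ} (D : RBFData n)

/-- The affine hyperplane `p vᵢ + vᵢ^⊥` of the base flat. -/
noncomputable def hyperplane (i : Fin (n + 1)) (p : ℝ) :
    AffineSubspace ℝ (EuclideanSpace ℝ (Fin n)) :=
  AffineSubspace.mk' (p • D.v i) (Submodule.span ℝ {D.v i})ᗮ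

/-- The points of the richly branching flat: those of the base flat, and, for each `i` and each
`p ∈ Pᵢ`, those of the open half-flat `A × (0, ∞)`, where `A` is the hyperplane `p vᵢ + vᵢ^⊥`
(a copy of `ℝⁿ⁻¹`). -/
inductive Point : Type
  | base (b : EuclideanSpace ℝ (Fin n)) : Point
  | wing (i : Fin (n + 1)) (p : D.P i) (a : D.hyperplane i p) (s : NNReal) (hs : 0 < s) : Point

open Classical in
/-- The closed half-flat `A × [0, ∞)` attached along the hyperplane `A = p vᵢ + vᵢ^⊥`: the
boundary point `(a, 0)` is the point `a` of the base flat. -/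
noncomputable def halfFlat (i : Fin (n + 1)) (p : D.P i) (a : D.hyperplane i p)
    (s : NNReal) : D.Point :=
  if hs : 0 < s then Point.wing i p a s hs else Point.base a

/-- `D.Step x y c`: the points `x` and `y` lie in a common flat piece (the base flat or one of the
closed half-flats), and their Euclidean distance in this piece is `c`. -/
inductive Step : D.Point → D.Point → ℝ → Prop
  | base (b b' : EuclideanSpace ℝ (Fin n)) : Step (Point.base b) (Point.base b') (dist b b')
  | half (i : Fin (n + 1)) (p : D.P i) (a a' : D.hyperplane i p) (s s' : NNReal) :
      Step (D.halfFlat i p a s) (D.halfFlat i p a' s')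
        (Real.sqrt (dist a a' ^ 2 + ((s : ℝ) - s') ^ 2))

/-- `D.Chain x y ℓ`: a piecewise straight path of length `ℓ` leads from `x` to `y`. -/
inductive Chain : D.Point → D.Point → ℝ → Prop
  | nil (x : D.Point) : Chain x x 0
  | cons {x y z : D.Point} {c ℓ : ℝ} : D.Step x y c → Chain y z ℓ → Chain x z (c + ℓ)

/-- The path metric of the richly branching flat: the infimum of the lengths of the piecewise
straight paths between two points. -/
noncomputable def pathDist (x y : D.Point) : ℝ := sInf {ℓ | D.Chain x y ℓ}

end RBFData

/-- The finitely generated group `G` contains a quasiisometrically embedded `n`-dimensional richly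
branching flat. -/
def HasQIEmbeddedRBF (n : ℕ) (G : Type*) [Group G] : Prop :=
  Group.FG G ∧ ∃ (D : RBFData n) (f : D.Point → G), ∀ S : Set G, IsFiniteGenerating S →
    IsQIEmbedding D.pathDist (wordDist S) f

/-! ### Word lengths -/

section WordLength

variable {G : Type*} [Group G] {S : Set G}

/-! The base flat is the vertex group at `v`, a copy of ℤ². Pairwise non-commensurable infinite
cyclic subgroups of ℤ² have pairwise independent generators `h i`. Across the `i`-th edge, each
coset of its edge group in the vertex group borders a translate of the vertex group at the other
end, and half of that translate is a wing on a line with direction `h i`. Only the lines through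
integer multiples of the quarter turn of `h i` receive wings; they are already coarsely dense.

Group distances are at most linear in flat distances, because each piece is the image of ℤ² under a
homomorphism and a route through the foot of a wing can be imitated in the group
(`exists_groupDist_le`). Conversely, each piece is undistorted by hypothesis, and there are no
shortcuts between pieces: a path from a wing to a point elsewhere passes near the attaching line
(`Separated`), so its length splits at a point of that line (`exists_pointDist_le`).

Separation expresses that an edge of the Bass–Serre tree disconnects the tree. In place of the tree
there is an affine action of the fundamental group on the permutation module of the cosets of an
edge group (`exists_affineAction`). Each coset of a vertex group determines a point of the module.
Adjacent cosets determine the same point unless a translate of the given edge joins them; then the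
points differ by plus or minus the basis vector of that translate. A coordinate thus tells the two
sides of an edge apart. Generators displace the base points by finitely many vectors of finite
support, so a coordinate can change along a path only near the corresponding coset of the edge group
(`exists_near_coset`). -/

theorem exists_word (hS : Subgroup.closure S = ⊤) (g : G) :
    ∃ l : List G, l.length = wordLength S g ∧ (∀ x ∈ l, x ∈ S ∨ x⁻¹ ∈ S) ∧ l.prod = g := by
  have hg : g ∈ (Subgroup.closure S).toSubmonoid := by rw [hS]; trivial
  rw [Subgroup.closure_toSubmonoid] at hg
  obtain ⟨l, hl, hp⟩ := Submonoid.exists_list_of_mem_closure hg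
  exact Nat.sInf_mem (s := {n | ∃ l : List G, l.length = n ∧ (∀ x ∈ l, x ∈ S ∨ x⁻¹ ∈ S) ∧
    l.prod = g}) ⟨l.length, l, rfl, fun x hx => hl x hx, hp⟩

theorem wordLength_prod_le {l : List G} (hl : ∀ x ∈ l, x ∈ S ∨ x⁻¹ ∈ S) :
    wordLength S l.prod ≤ l.length :=
  Nat.sInf_le ⟨l, rfl, hl, rfl⟩

@[simp] theorem wordLength_one : wordLength S (1 : G) = 0 :=
  Nat.le_zero.1 (wordLength_prod_le (S := S) (l := []) (by simp))

theorem wordLength_mul_le (hS : Subgroup.closure S = ⊤) (g h : G) :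
    wordLength S (g * h) ≤ wordLength S g + wordLength S h := by
  obtain ⟨l, hl, hlS, rfl⟩ := exists_word hS g
  obtain ⟨m, hm, hmS, rfl⟩ := exists_word hS h
  rw [← hl, ← hm, ← List.length_append, ← List.prod_append]
  refine wordLength_prod_le fun x hx => ?_
  rcases List.mem_append.1 hx with h | h
  exacts [hlS x h, hmS x h]

theorem wordLength_inv_le (hS : Subgroup.closure S = ⊤) (g : G) :
    wordLength S g⁻¹ ≤ wordLength S g := by
  obtain ⟨l, hl, hlS, rfl⟩ := exists_word hS g
  rw [← hl, List.prod_inv_reverse]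
  refine (wordLength_prod_le ?_).trans (by simp)
  intro x hx
  simp only [List.mem_reverse, List.mem_map] at hx
  obtain ⟨y, hy, rfl⟩ := hx
  rw [inv_inv]
  exact (hlS y hy).symm

theorem wordLength_inv (hS : Subgroup.closure S = ⊤) (g : G) :
    wordLength S g⁻¹ = wordLength S g :=
  (wordLength_inv_le hS g).antisymm (by simpa using wordLength_inv_le hS g⁻¹)

/-- A symmetric subadditive function is bounded by a multiple of the word length. -/
theorem exists_le_mul_wordLength (hS : IsFiniteGenerating S) (L : G → ℝ) (h1 : L 1 ≤ 0)
    (hmul : ∀ g h, L (g * h) ≤ L g + L h) (hinv : ∀ g, L g⁻¹ ≤ L g) :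
    ∃ K : ℝ, 0 ≤ K ∧ ∀ g, L g ≤ K * wordLength S g := by
  obtain ⟨K, hK⟩ := (hS.1.image L).bddAbove
  have hK' : ∀ x ∈ S, L x ≤ max K 0 := fun x hx =>
    (hK (Set.mem_image_of_mem L hx)).trans (le_max_left _ _)
  refine ⟨max K 0, le_max_right _ _, fun g => ?_⟩
  obtain ⟨l, hl, hlS, rfl⟩ := exists_word hS.2 g
  rw [← hl]
  clear hl
  induction l with
  | nil => simpa using h1
  | cons x l ih =>
    have hx : L x ≤ max K 0 := by
      rcases hlS x (by simp) with h | h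
      · exact hK' x h
      · have := hinv x⁻¹
        rw [inv_inv] at this
        exact this.trans (hK' _ h)
    have := ih fun y hy => hlS y (by simp [hy])
    simp only [List.prod_cons, List.length_cons, Nat.cast_add, Nat.cast_one]
    linarith [hmul x l.prod]

theorem exists_wordLength_le_mul {S' : Set G} (hS : IsFiniteGenerating S)
    (hS' : IsFiniteGenerating S') :
    ∃ K : ℝ, 0 ≤ K ∧ ∀ g : G, (wordLength S' g : ℝ) ≤ K * wordLength S g :=
  exists_le_mul_wordLength hS (fun g => (wordLength S' g : ℝ)) (by simp)
    (fun g h => by exact_mod_cast wordLength_mul_le hS'.2 g h)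
    (fun g => by exact_mod_cast wordLength_inv_le hS'.2 g)

theorem wordLength_pow_le (hS : Subgroup.closure S = ⊤) (g : G) (n : ℕ) :
    wordLength S (g ^ n) ≤ n * wordLength S g := by
  induction n with
  | zero => simp
  | succ n ih =>
    rw [pow_succ, Nat.succ_mul]
    exact (wordLength_mul_le hS _ _).trans (by omega)

theorem wordLength_zpow_le (hS : Subgroup.closure S = ⊤) (g : G) (n : ℤ) :
    (wordLength S (g ^ n) : ℝ) ≤ |(n : ℝ)| * wordLength S g := by
  have hn : |(n : ℝ)| = (n.natAbs : ℝ) := by rw [Nat.cast_natAbs, Int.cast_abs]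
  rw [hn]
  rcases Int.natAbs_eq n with h | h
  · have := wordLength_pow_le hS g n.natAbs
    rw [h, zpow_natCast]
    exact_mod_cast this
  · have := wordLength_pow_le hS g n.natAbs
    rw [h, zpow_neg, zpow_natCast, wordLength_inv hS]
    simp only [Int.natAbs_neg, Int.natAbs_natCast]
    exact_mod_cast this

theorem wordDist_triangle (hS : Subgroup.closure S = ⊤) (x y z : G) :
    wordDist S x z ≤ wordDist S x y + wordDist S y z := by
  have := wordLength_mul_le hS (x⁻¹ * y) (y⁻¹ * z)
  rw [show x⁻¹ * y * (y⁻¹ * z) = x⁻¹ * z by group] at this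
  unfold wordDist
  exact_mod_cast this

theorem wordDist_comm (hS : Subgroup.closure S = ⊤) (x y : G) :
    wordDist S x y = wordDist S y x := by
  unfold wordDist
  rw [← wordLength_inv hS, mul_inv_rev, inv_inv]

theorem wordDist_nonneg (x y : G) : 0 ≤ wordDist S x y := Nat.cast_nonneg _

theorem wordDist_mul_left (g x y : G) : wordDist S (g * x) (g * y) = wordDist S x y := by
  unfold wordDist
  congr 2
  group

theorem wordDist_mul_right (g x : G) : wordDist S g (g * x) = wordLength S x := by
  simp [wordDist]

end WordLength

/-! ### Undistorted copies of the lattice -/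

/-- The `ℓ¹` norm on the lattice `ℤ²`. -/
def latticeNorm (z : ℤ × ℤ) : ℝ := |(z.1 : ℝ)| + |(z.2 : ℝ)|

theorem latticeNorm_nonneg (z : ℤ × ℤ) : 0 ≤ latticeNorm z := by
  unfold latticeNorm; positivity

theorem latticeNorm_add_le (z w : ℤ × ℤ) : latticeNorm (z + w) ≤ latticeNorm z + latticeNorm w := by
  unfold latticeNorm
  push_cast [Prod.fst_add, Prod.snd_add]
  linarith [abs_add_le (z.1 : ℝ) w.1, abs_add_le (z.2 : ℝ) w.2]

theorem latticeNorm_neg (z : ℤ × ℤ) : latticeNorm (-z) = latticeNorm z := by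
  simp [latticeNorm]

theorem one_le_latticeNorm {z : ℤ × ℤ} (hz : z ≠ 0) : 1 ≤ latticeNorm z := by
  unfold latticeNorm
  have : 1 ≤ |z.1| + |z.2| := by
    by_contra! h
    have h1 : z.1 = 0 := abs_eq_zero.1 (by have := abs_nonneg z.1; have := abs_nonneg z.2; omega)
    have h2 : z.2 = 0 := abs_eq_zero.1 (by have := abs_nonneg z.1; have := abs_nonneg z.2; omega)
    exact hz (Prod.ext h1 h2)
  exact_mod_cast this

open Multiplicative (ofAdd) in
/-- The word length of `φ z` grows at least linearly in `z`. -/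
def GrowsLinearly {G : Type*} [Group G] (S : Set G) (φ : Multiplicative (ℤ × ℤ) →* G) : Prop :=
  ∃ A B : ℝ, 0 ≤ A ∧ ∀ z : ℤ × ℤ, latticeNorm z ≤ A * wordLength S (φ (ofAdd z)) + B

section Lattice

open Multiplicative (ofAdd toAdd)

variable {G : Type*} [Group G] {S : Set G}

theorem GrowsLinearly.change_generators {S' : Set G} {φ : Multiplicative (ℤ × ℤ) →* G}
    (h : GrowsLinearly S φ) (hS : IsFiniteGenerating S) (hS' : IsFiniteGenerating S') :
    GrowsLinearly S' φ := by
  obtain ⟨A, B, hA, h⟩ := h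
  obtain ⟨K, hK, hKS⟩ := exists_wordLength_le_mul hS' hS
  refine ⟨A * K, B, by positivity, fun z => (h z).trans ?_⟩
  have := mul_le_mul_of_nonneg_left (hKS (φ (ofAdd z))) hA
  linarith

/-- The multiples of a nonzero kernel element have unbounded norm but word length zero. Undistorted
vertex groups therefore embed without any appeal to normal forms. -/
theorem GrowsLinearly.injective {φ : Multiplicative (ℤ × ℤ) →* G}
    (h : GrowsLinearly S φ) : Function.Injective φ := by
  obtain ⟨A, B, hA, h⟩ := h
  refine (injective_iff_map_eq_one φ).2 fun z hz => ?_
  by_contra hne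
  obtain ⟨n, hn⟩ := exists_nat_gt B
  have h1 := h (n • toAdd z)
  rw [ofAdd_nsmul, ofAdd_toAdd, map_pow, hz, one_pow, wordLength_one] at h1
  have h2 : latticeNorm (n • toAdd z) = n * latticeNorm (toAdd z) := by
    simp [latticeNorm, abs_mul, mul_add]
  have h3 : 1 ≤ latticeNorm (toAdd z) := one_le_latticeNorm fun h0 => hne (by
    rw [← ofAdd_toAdd z, h0, ofAdd_zero])
  rw [h2] at h1
  have : (n : ℝ) * 1 ≤ n * latticeNorm (toAdd z) := by gcongr
  simp only [Nat.cast_zero, mul_zero, zero_add] at h1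
  linarith

theorem exists_wordLength_map_le (hS : Subgroup.closure S = ⊤)
    (φ : Multiplicative (ℤ × ℤ) →* G) :
    ∃ K : ℝ, 0 ≤ K ∧ ∀ z : ℤ × ℤ, (wordLength S (φ (ofAdd z)) : ℝ) ≤ K * latticeNorm z := by
  set a := φ (ofAdd (1, 0))
  set b := φ (ofAdd (0, 1))
  refine ⟨wordLength S a + wordLength S b, by positivity, fun z => ?_⟩
  have hz : φ (ofAdd z) = a ^ z.1 * b ^ z.2 := by
    have e : z = z.1 • ((1, 0) : ℤ × ℤ) + z.2 • ((0, 1) : ℤ × ℤ) := by ext <;> simp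
    conv_lhs => rw [e, ofAdd_add, map_mul, ofAdd_zsmul, ofAdd_zsmul, map_zpow, map_zpow]
  have h1 : (wordLength S (φ (ofAdd z)) : ℝ) ≤ wordLength S (a ^ z.1) + wordLength S (b ^ z.2) := by
    rw [hz]
    exact_mod_cast wordLength_mul_le hS _ _
  have h2 := wordLength_zpow_le hS a z.1
  have h3 := wordLength_zpow_le hS b z.2
  unfold latticeNorm
  have h4 : 0 ≤ |(z.2 : ℝ)| * wordLength S a := by positivity
  have h5 : 0 ≤ |(z.1 : ℝ)| * wordLength S b := by positivity
  linarith

/-- An undistorted copy of `ℤ²` has linear growth in the ambient group. -/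
theorem IsUndistortedHom.exists_growsLinearly {H : Type*} [Group H] {f : H →* G}
    (hf : IsUndistortedHom f) (e : H ≃* Multiplicative (ℤ × ℤ)) :
    ∃ S : Set G, IsFiniteGenerating S ∧ GrowsLinearly S (f.comp e.symm.toMonoidHom) := by
  obtain ⟨S, S', hS, hS', K, C, hK, hC, hqi⟩ := hf
  refine ⟨S', hS', ?_⟩
  obtain ⟨A, hA, hAS⟩ := exists_le_mul_wordLength hS (fun g => latticeNorm (toAdd (e g)))
    (by simp [latticeNorm]) (fun g h => by simpa using latticeNorm_add_le _ _)
    (fun g => by simp [latticeNorm_neg])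
  refine ⟨A * K, A * K * C, by positivity, fun z => ?_⟩
  have h1 := hAS (e.symm (ofAdd z))
  have h2 := (hqi 1 (e.symm (ofAdd z))).1
  simp only [wordDist, inv_one, one_mul, map_one] at h2
  simp only [MulEquiv.apply_symm_apply, toAdd_ofAdd] at h1
  have hK0 : 0 < K := by linarith
  have h3 : (wordLength S (e.symm (ofAdd z)) : ℝ) ≤
      K * (wordLength S' (f (e.symm (ofAdd z))) + C) := by
    rw [sub_le_iff_le_add, div_le_iff₀ hK0] at h2
    linarith
  have h4 := mul_le_mul_of_nonneg_left h3 hA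
  simp only [MonoidHom.coe_comp, Function.comp_apply, MulEquiv.toMonoidHom_eq_coe,
    MonoidHom.coe_coe]
  linarith

theorem IsUndistortedHom.growsLinearly {H : Type*} [Group H] {f : H →* G}
    (hf : IsUndistortedHom f) (e : H ≃* Multiplicative (ℤ × ℤ)) (hS : IsFiniteGenerating S) :
    GrowsLinearly S (f.comp e.symm.toMonoidHom) := by
  obtain ⟨S', hS', h⟩ := hf.exists_growsLinearly e
  exact h.change_generators hS' hS

end Lattice

/-! ### The metric of a richly branching flat -/

namespace RBFData

variable {n : ℕ} (D : RBFData n)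

/-- The nearest point of the base flat. -/
def proj : D.Point → EuclideanSpace ℝ (Fin n)
  | .base b => b
  | .wing _ _ a _ _ => a

/-- The distance from the base flat. -/
def height : D.Point → ℝ
  | .base _ => 0
  | .wing _ _ _ s _ => s

/-- The half-flat that contains a point outside the base flat. -/
def sheet : D.Point → Option (Σ i, D.P i)
  | .base _ => none
  | .wing i p _ _ _ => some ⟨i, p⟩

open Classical in
/-- The metric given by the sum of the distances along the base flat and along the half-flats. -/
noncomputable def taxiDist (x y : D.Point) : ℝ :=
  dist (D.proj x) (D.proj y) +
    if D.sheet x = D.sheet y then |D.height x - D.height y| else D.height x + D.height y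

@[simp] theorem proj_base (b : EuclideanSpace ℝ (Fin n)) : D.proj (.base b) = b := rfl

@[simp] theorem height_base (b : EuclideanSpace ℝ (Fin n)) : D.height (.base b) = 0 := rfl

@[simp] theorem sheet_base (b : EuclideanSpace ℝ (Fin n)) : D.sheet (.base b) = none := rfl

theorem height_nonneg (x : D.Point) : 0 ≤ D.height x := by
  cases x <;> simp [height]

theorem taxiDist_self (x : D.Point) : D.taxiDist x x = 0 := by simp [taxiDist]

theorem taxiDist_comm (x y : D.Point) : D.taxiDist x y = D.taxiDist y x := by
  unfold taxiDist
  rw [dist_comm, abs_sub_comm, add_comm (D.height x)]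
  simp only [eq_comm]

theorem taxiDist_triangle (x y z : D.Point) :
    D.taxiDist x z ≤ D.taxiDist x y + D.taxiDist y z := by
  unfold taxiDist
  have h := dist_triangle (D.proj x) (D.proj y) (D.proj z)
  have hx := D.height_nonneg x
  have hy := D.height_nonneg y
  have hz := D.height_nonneg z
  have h1 := abs_sub_le (D.height x) (D.height y) (D.height z)
  have h2 := le_abs_self (D.height x - D.height y)
  have h3 := neg_abs_le (D.height x - D.height y)
  have h4 := le_abs_self (D.height y - D.height z)
  have h5 := neg_abs_le (D.height y - D.height z)
  have h6 : |D.height x - D.height z| ≤ D.height x + D.height z := by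
    rw [abs_le]; constructor <;> linarith
  split_ifs with h₁ h₂ h₃ h₃ h₂ h₃ h₃
  all_goals first
    | linarith
    | exact absurd (h₂.trans h₃) h₁

theorem proj_halfFlat (i : Fin (n + 1)) (p : D.P i) (a : D.hyperplane i p) (s : NNReal) :
    D.proj (D.halfFlat i p a s) = a := by
  unfold halfFlat
  split_ifs <;> rfl

theorem height_halfFlat (i : Fin (n + 1)) (p : D.P i) (a : D.hyperplane i p) (s : NNReal) :
    D.height (D.halfFlat i p a s) = s := by
  unfold halfFlat
  split_ifs with hs
  · rfl
  · simp [height, nonpos_iff_eq_zero.1 (not_lt.1 hs)]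

theorem sheet_halfFlat {i : Fin (n + 1)} {p : D.P i} (a : D.hyperplane i p) {s : NNReal}
    (hs : 0 < s) : D.sheet (D.halfFlat i p a s) = some ⟨i, p⟩ := by
  simp [halfFlat, hs, sheet]

theorem halfFlat_zero (i : Fin (n + 1)) (p : D.P i) (a : D.hyperplane i p) :
    D.halfFlat i p a 0 = .base (a : EuclideanSpace ℝ (Fin n)) := by
  simp [halfFlat]

/-- Boundary points belong to no sheet, so the two sheets may disagree; then one of the heights is
zero, and sum and absolute difference of the heights coincide. -/
theorem taxiDist_halfFlat (i : Fin (n + 1)) (p : D.P i) (a a' : D.hyperplane i p)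
    (s s' : NNReal) :
    D.taxiDist (D.halfFlat i p a s) (D.halfFlat i p a' s') = dist a a' + |(s : ℝ) - s'| := by
  unfold taxiDist
  simp only [proj_halfFlat, height_halfFlat]
  congr 1
  split_ifs with h
  · rfl
  · rcases eq_or_ne s 0 with rfl | hs
    · simp
    · rcases eq_or_ne s' 0 with rfl | hs'
      · simp
      · exact absurd ((D.sheet_halfFlat a (pos_iff_ne_zero.2 hs)).trans
          (D.sheet_halfFlat a' (pos_iff_ne_zero.2 hs')).symm) h

/-- Inside a half-flat each leg of a right triangle is at most the hypotenuse, whence the factor 2.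
-/
theorem Step.taxiDist_le {x y : D.Point} {c : ℝ} (h : D.Step x y c) :
    D.taxiDist x y ≤ 2 * c := by
  cases h with
  | base b b' =>
    have : 0 ≤ dist b b' := dist_nonneg
    simp only [taxiDist, proj, sheet, height]
    simp only [if_true, sub_self, abs_zero]
    linarith
  | half i p a a' s s' =>
    rw [taxiDist_halfFlat]
    have h1 : dist a a' ≤ Real.sqrt (dist a a' ^ 2 + ((s : ℝ) - s') ^ 2) :=
      Real.le_sqrt_of_sq_le (by nlinarith [sq_nonneg ((s : ℝ) - s')])
    have h2 : |(s : ℝ) - s'| ≤ Real.sqrt (dist a a' ^ 2 + ((s : ℝ) - s') ^ 2) :=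
      Real.abs_le_sqrt (by nlinarith [sq_nonneg (dist a a')])
    linarith

theorem Step.nonneg {x y : D.Point} {c : ℝ} (h : D.Step x y c) : 0 ≤ c := by
  cases h with
  | base b b' => exact dist_nonneg
  | half i p a a' s s' => exact Real.sqrt_nonneg _

theorem Chain.nonneg {x y : D.Point} {c : ℝ} (h : D.Chain x y c) : 0 ≤ c := by
  induction h with
  | nil => exact le_rfl
  | cons h _ ih => exact add_nonneg (Step.nonneg D h) ih

theorem Chain.taxiDist_le {x y : D.Point} {c : ℝ} (h : D.Chain x y c) :
    D.taxiDist x y ≤ 2 * c := by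
  induction h with
  | nil x => simp [taxiDist_self]
  | @cons x y z c l h _ ih =>
    have := Step.taxiDist_le D h
    linarith [D.taxiDist_triangle x y z]

theorem Chain.append {x y z : D.Point} {c c' : ℝ} (h : D.Chain x y c) (h' : D.Chain y z c') :
    D.Chain x z (c + c') := by
  induction h with
  | nil => simpa using h'
  | cons hs _ ih => rw [add_assoc]; exact .cons hs (ih h')

theorem Step.chain {x y : D.Point} {c : ℝ} (h : D.Step x y c) : D.Chain x y c := by
  simpa using Chain.cons h (Chain.nil y)

theorem chain_base_proj (x : D.Point) : D.Chain x (.base (D.proj x)) (D.height x) := by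
  cases x with
  | base b => exact .nil _
  | wing i p a s hs =>
    have := Step.chain D (Step.half (D := D) i p a a s 0)
    rw [halfFlat_zero] at this
    simpa [halfFlat, hs, proj, height] using this

theorem chain_proj_base (x : D.Point) : D.Chain (.base (D.proj x)) x (D.height x) := by
  cases x with
  | base b => exact .nil _
  | wing i p a s hs =>
    have := Step.chain D (Step.half (D := D) i p a a 0 s)
    rw [halfFlat_zero] at this
    simpa [halfFlat, hs, proj, height] using this

theorem pathDist_le_of_chain {x y : D.Point} {c : ℝ} (h : D.Chain x y c) :
    D.pathDist x y ≤ c :=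
  csInf_le ⟨0, fun _ h => Chain.nonneg D h⟩ h

theorem chain_through_base (x y : D.Point) :
    D.Chain x y (D.height x + (dist (D.proj x) (D.proj y) + D.height y)) :=
  Chain.append D (D.chain_base_proj x)
    (Chain.append D (Step.chain D (.base _ _)) (D.chain_proj_base y))

/-- On a common sheet the hypotenuse is at most the sum of the legs; otherwise the path through both
feet has exactly the taxicab length. -/
theorem pathDist_le_taxiDist (x y : D.Point) : D.pathDist x y ≤ D.taxiDist x y := by
  by_cases hxy : D.sheet x = D.sheet y
  · cases x with
    | base b =>
      cases y with
      | base b' =>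
        refine (D.pathDist_le_of_chain (Step.chain D (.base b b'))).trans ?_
        simp [taxiDist, proj, sheet, height]
      | wing j q a' s' hs' => simp [sheet] at hxy
    | wing i p a s hs =>
      cases y with
      | base b' => simp [sheet] at hxy
      | wing j q a' s' hs' =>
        simp only [sheet, Option.some.injEq, Sigma.mk.injEq] at hxy
        obtain ⟨rfl, hq⟩ := hxy
        obtain rfl := eq_of_heq hq
        have h1 := Step.chain D (.half i p a a' s s')
        have h2 := D.taxiDist_halfFlat i p a a' s s'
        have e1 : D.halfFlat i p a s = .wing i p a s hs := by simp [halfFlat, hs]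
        have e2 : D.halfFlat i p a' s' = .wing i p a' s' hs' := by simp [halfFlat, hs']
        rw [e1, e2] at h1 h2
        refine (D.pathDist_le_of_chain h1).trans ?_
        rw [h2, Real.sqrt_le_left (by positivity)]
        have : 0 ≤ dist a a' * |(s : ℝ) - s'| := by positivity
        nlinarith [sq_abs ((s : ℝ) - s')]
  · refine (D.pathDist_le_of_chain (D.chain_through_base x y)).trans ?_
    simp only [taxiDist, if_neg hxy]
    linarith

theorem taxiDist_le_pathDist (x y : D.Point) : D.taxiDist x y ≤ 2 * D.pathDist x y := by
  have : D.taxiDist x y / 2 ≤ D.pathDist x y :=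
    le_csInf ⟨_, D.chain_through_base x y⟩ fun c hc => by
      have := Chain.taxiDist_le D hc
      linarith
  linarith

theorem pathDist_nonneg (x y : D.Point) : 0 ≤ D.pathDist x y :=
  Real.sInf_nonneg fun _ h => Chain.nonneg D h

/-- To check that a map is a quasiisometric embedding, the path metric may be replaced by the
taxicab metric. -/
theorem isQIEmbedding_of_taxiDist {Y : Type*} {dY : Y → Y → ℝ} {f : D.Point → Y} {K C : ℝ}
    (hK : 0 ≤ K) (h_nonneg : ∀ x y, 0 ≤ dY x y)
    (hl : ∀ x y, D.taxiDist x y ≤ K * dY (f x) (f y) + C)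
    (hu : ∀ x y, dY (f x) (f y) ≤ K * D.taxiDist x y + C) :
    IsQIEmbedding D.pathDist dY f := by
  -- The factor 2 is the loss from the taxicab to the path metric; the summand 1 makes the constant
  -- at least 1.
  have hK' : (1 : ℝ) ≤ 2 * K + 1 := by linarith
  refine ⟨2 * K + 1, |C|, hK', abs_nonneg _, fun x y => ⟨?_, ?_⟩⟩
  · have h1 := (D.pathDist_le_taxiDist x y).trans (hl x y)
    have h0 := D.pathDist_nonneg x y
    have h2 := le_abs_self C
    have h3 := abs_nonneg C
    rw [sub_le_iff_le_add, div_le_iff₀ (by linarith)]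
    have h := h_nonneg (f x) (f y)
    nlinarith
  · have h1 := hu x y
    have h2 := mul_le_mul_of_nonneg_left (D.taxiDist_le_pathDist x y) hK
    have h3 := le_abs_self C
    have h0 := D.pathDist_nonneg x y
    nlinarith

end RBFData

/-! ### Lattice vectors in the Euclidean plane -/

section LatticeVectors

/-- A vector of the lattice `ℤ²`, as a vector of the Euclidean plane. -/
noncomputable def latticeVec (z : ℤ × ℤ) : EuclideanSpace ℝ (Fin 2) := !₂[(z.1 : ℝ), (z.2 : ℝ)]

@[simp] theorem latticeVec_apply_zero (z : ℤ × ℤ) : latticeVec z 0 = z.1 := rfl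

@[simp] theorem latticeVec_apply_one (z : ℤ × ℤ) : latticeVec z 1 = z.2 := rfl

/-- The lattice vector turned by a right angle. -/
def quarterTurn (z : ℤ × ℤ) : ℤ × ℤ := (-z.2, z.1)

theorem EuclideanSpace.dist_le_abs_add_abs (a b : EuclideanSpace ℝ (Fin 2)) :
    dist a b ≤ |a 0 - b 0| + |a 1 - b 1| := by
  rw [EuclideanSpace.dist_eq, Fin.sum_univ_two, Real.sqrt_le_left (by positivity),
    Real.dist_eq, Real.dist_eq]
  have : 0 ≤ |a 0 - b 0| * |a 1 - b 1| := by positivity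
  nlinarith

theorem EuclideanSpace.abs_add_abs_le_dist (a b : EuclideanSpace ℝ (Fin 2)) :
    |a 0 - b 0| + |a 1 - b 1| ≤ 2 * dist a b := by
  have h (i : Fin 2) : |a i - b i| ≤ dist a b := by
    rw [EuclideanSpace.dist_eq, Fin.sum_univ_two]
    refine Real.le_sqrt_of_sq_le ?_
    rw [Real.dist_eq, Real.dist_eq]
    fin_cases i
    · simpa using sq_nonneg (a 1 - b 1)
    · simpa using sq_nonneg (a 0 - b 0)
  linarith [h 0, h 1]

theorem dist_latticeVec_le (z w : ℤ × ℤ) :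
    dist (latticeVec z) (latticeVec w) ≤ latticeNorm (z - w) := by
  refine (EuclideanSpace.dist_le_abs_add_abs _ _).trans (le_of_eq ?_)
  simp [latticeNorm]

theorem latticeNorm_sub_le (z w : ℤ × ℤ) :
    latticeNorm (z - w) ≤ 2 * dist (latticeVec z) (latticeVec w) := by
  refine (le_of_eq ?_).trans (EuclideanSpace.abs_add_abs_le_dist _ _)
  simp [latticeNorm]

theorem latticeNorm_zsmul (n : ℤ) (z : ℤ × ℤ) :
    latticeNorm (n • z) = |(n : ℝ)| * latticeNorm z := by
  simp [latticeNorm, abs_mul, mul_add]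

theorem latticeNorm_quarterTurn (z : ℤ × ℤ) : latticeNorm (quarterTurn z) = latticeNorm z := by
  simp [latticeNorm, quarterTurn, add_comm]

/-- The vectors `z` and `quarterTurn z` are orthogonal of equal length, so the inner product with
`z` isolates `x`. Integrality gives `|a|, |b| ≤ a ^ 2 + b ^ 2`, which makes the constant independent
of `z`. -/
theorem abs_add_abs_le_latticeNorm {z : ℤ × ℤ} (hz : z ≠ 0) (x y : ℤ) :
    |(x : ℝ)| + |(y : ℝ)| ≤ 2 * latticeNorm (x • z + y • quarterTurn z) := by
  obtain ⟨a, b⟩ := z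
  have key : ∀ x y : ℤ, |x| ≤ |x * a - y * b| + |x * b + y * a| := by
    intro x y
    have hpos : 0 < a ^ 2 + b ^ 2 := by
      by_contra! h
      have ha : a = 0 := by nlinarith [sq_nonneg a, sq_nonneg b]
      have hb : b = 0 := by nlinarith [sq_nonneg a, sq_nonneg b]
      exact hz (by simp [ha, hb])
    have hsq (c : ℤ) : |c| ≤ c ^ 2 := by
      rw [← sq_abs c]
      rcases eq_or_ne c 0 with rfl | hc
      · simp
      · have := Int.one_le_abs hc
        nlinarith
    have h1 : |x| * (a ^ 2 + b ^ 2) = |(x * a - y * b) * a + (x * b + y * a) * b| := by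
      rw [show (x * a - y * b) * a + (x * b + y * a) * b = x * (a ^ 2 + b ^ 2) by ring, abs_mul,
        abs_of_pos hpos]
    have h2 := abs_add_le ((x * a - y * b) * a) ((x * b + y * a) * b)
    rw [abs_mul, abs_mul] at h2
    have h3 : |a| ≤ a ^ 2 + b ^ 2 := by nlinarith [hsq a, sq_nonneg b]
    have h4 : |b| ≤ a ^ 2 + b ^ 2 := by nlinarith [hsq b, sq_nonneg a]
    have h5 := mul_le_mul_of_nonneg_left h3 (abs_nonneg (x * a - y * b))
    have h6 := mul_le_mul_of_nonneg_left h4 (abs_nonneg (x * b + y * a))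
    nlinarith
  have h1 := key x y
  -- Turning the combination back by a right angle exchanges the roles of the two coefficients.
  have h2 := key y (-x)
  rw [show y * a - -x * b = x * b + y * a by ring,
    show y * b + -x * a = -(x * a - y * b) by ring, abs_neg] at h2
  have h1' : |(x : ℝ)| ≤ |(x : ℝ) * a - y * b| + |(x : ℝ) * b + y * a| := by exact_mod_cast h1
  have h2' : |(y : ℝ)| ≤ |(x : ℝ) * b + y * a| + |(x : ℝ) * a - y * b| := by exact_mod_cast h2
  simp only [latticeNorm, quarterTurn, Prod.smul_mk, Prod.mk_add_mk, smul_eq_mul]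
  push_cast
  rw [show (x : ℝ) * a + y * -b = x * a - y * b by ring]
  linarith

end LatticeVectors

/-! ### Lattices with branches -/

open Multiplicative (ofAdd) in
/-- A copy `φ` of `ℤ²` in a group, with three pairwise independent directions `h i`, and for each of
these directions a further copy `ψ i` of `ℤ²`, whose translate by `τ i` contains a line with
direction `h i`. -/
structure BranchedLattice (G : Type*) [Group G] where
  φ : Multiplicative (ℤ × ℤ) →* G
  ψ : Fin 3 → Multiplicative (ℤ × ℤ) →* G
  τ : Fin 3 → G
  h : Fin 3 → ℤ × ℤ
  h' : Fin 3 → ℤ × ℤ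
  indep : Pairwise fun i j => (h i).1 * (h j).2 ≠ (h i).2 * (h j).1
  h'_ne_zero : ∀ i, h' i ≠ 0
  comm : ∀ i, φ (ofAdd (h i)) * τ i = τ i * ψ i (ofAdd (h' i))

/-- The points of the lattice, and of the half-lattices attached to its lines: the line
of the wing `(i, k)` is the one through `k • quarterTurn (h i)` with direction `h i`. -/
inductive LatticePoint : Type
  | flat (z : ℤ × ℤ) : LatticePoint
  | wing (i : Fin 3) (k r : ℤ) (s : ℕ) : LatticePoint

namespace BranchedLattice

open Multiplicative (ofAdd)
open LatticePoint

variable {G : Type*} [Group G] (L : BranchedLattice G)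

/-- The lattice vector of the foot of a point on a wing. -/
def foot (i : Fin 3) (k r : ℤ) : ℤ × ℤ := k • quarterTurn (L.h i) + r • L.h i

/-- A vector of the `i`-th attached lattice. -/
def sideVec (i : Fin 3) (r s : ℤ) : ℤ × ℤ := r • L.h' i + s • quarterTurn (L.h' i)

/-- The group element of a lattice point. -/
def toGroup : LatticePoint → G
  | flat z => L.φ (ofAdd z)
  | wing i k r s => L.φ (ofAdd (k • quarterTurn (L.h i))) * L.τ i * L.ψ i (ofAdd (L.sideVec i r s))

theorem h_ne_zero (i : Fin 3) : L.h i ≠ 0 := by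
  intro h
  obtain ⟨j, hj⟩ := exists_ne i
  exact L.indep hj (by simp [h])

/-- The richly branching flat that a branched lattice approximates. -/
noncomputable def rbf : RBFData 2 where
  -- The turned vector is normal to `h i`, so the hyperplane at level `k` is the line through `k •
  -- quarterTurn (h i)` with direction `h i`.
  v i := latticeVec (quarterTurn (L.h i))
  indep := by
    intro i j hij
    refine LinearIndependent.pair_iff.2 fun s t hst => ?_
    have h0 := congrArg (fun x : EuclideanSpace ℝ (Fin 2) => x 0) hst
    have h1 := congrArg (fun x : EuclideanSpace ℝ (Fin 2) => x 1) hst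
    simp [quarterTurn] at h0 h1
    have hd : ((L.h i).1 * (L.h j).2 - (L.h i).2 * (L.h j).1 : ℝ) ≠ 0 := by
      rw [sub_ne_zero]
      exact_mod_cast L.indep hij
    constructor
    · refine (mul_eq_zero.1 (?_ : s * _ = 0)).resolve_right hd
      linear_combination (L.h j).2 * h1 + (L.h j).1 * h0
    · refine (mul_eq_zero.1 (?_ : t * _ = 0)).resolve_right hd
      linear_combination -((L.h i).2 : ℝ) * h1 - (L.h i).1 * h0
  P _ := Set.range ((↑) : ℤ → ℝ)
  dense _ := ⟨1, fun t => ⟨⌊t⌋, ⟨⌊t⌋, rfl⟩, by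
    rw [abs_of_nonneg (by linarith [Int.floor_le t])]
    linarith [Int.lt_floor_add_one t]⟩⟩

theorem mem_hyperplane {i : Fin 3} {p : ℝ} {a : EuclideanSpace ℝ (Fin 2)} :
    a ∈ L.rbf.hyperplane i p ↔
      (a 0 + p * (L.h i).2) * -(L.h i).2 + (a 1 - p * (L.h i).1) * (L.h i).1 = 0 := by
  unfold RBFData.hyperplane
  rw [AffineSubspace.mem_mk', Submodule.mem_orthogonal_singleton_iff_inner_right,
    PiLp.inner_apply, Fin.sum_univ_two]
  simp [rbf, quarterTurn]

/-- The attaching lines of the `i`-th kind are indexed by the integers. -/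
def level (i : Fin 3) (k : ℤ) : L.rbf.P i := ⟨(k : ℝ), k, rfl⟩

@[simp] theorem coe_level (i : Fin 3) (k : ℤ) : (L.level i k : ℝ) = k := rfl

theorem latticeVec_foot_mem (i : Fin 3) (k r : ℤ) :
    latticeVec (L.foot i k r) ∈ L.rbf.hyperplane i (L.level i k) := by
  rw [mem_hyperplane, coe_level]
  simp [foot, quarterTurn]
  ring

/-- The point of the richly branching flat given by a lattice point. -/
noncomputable def toPoint : LatticePoint → L.rbf.Point
  | flat z => .base (latticeVec z)
  | wing i k r s => L.rbf.halfFlat i (L.level i k) ⟨_, L.latticeVec_foot_mem i k r⟩ s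

/-- The coordinate of a point along the direction `h i`. -/
noncomputable def lineCoord (i : Fin 3) (a : EuclideanSpace ℝ (Fin 2)) : ℝ :=
  (a 0 * (L.h i).1 + a 1 * (L.h i).2) / ((L.h i).1 ^ 2 + (L.h i).2 ^ 2)

/-- A lattice point close to a point of the richly branching flat. -/
noncomputable def round : L.rbf.Point → LatticePoint
  | .base b => flat (⌊b 0⌋, ⌊b 1⌋)
  | .wing i p a s _ => wing i ⌊(p : ℝ)⌋ ⌊L.lineCoord i a⌋ ⌊s⌋₊

theorem exists_latticeNorm_h_le : ∃ M : ℝ, 0 ≤ M ∧ ∀ i, latticeNorm (L.h i) ≤ M := by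
  obtain ⟨M, hM⟩ := (Set.finite_range fun i => latticeNorm (L.h i)).bddAbove
  exact ⟨M, (latticeNorm_nonneg (L.h 0)).trans (hM ⟨0, rfl⟩), fun i => hM ⟨i, rfl⟩⟩

/-- In the orthogonal basis formed by `h i` and its quarter turn, a point of the line has
coordinates `lineCoord` and `p`. -/
theorem apply_eq_of_mem_hyperplane {i : Fin 3} {p : ℝ} {a : EuclideanSpace ℝ (Fin 2)}
    (ha : a ∈ L.rbf.hyperplane i p) :
    a 0 = -p * (L.h i).2 + L.lineCoord i a * (L.h i).1 ∧
      a 1 = p * (L.h i).1 + L.lineCoord i a * (L.h i).2 := by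
  rw [mem_hyperplane] at ha
  have hpos : ((L.h i).1 ^ 2 + (L.h i).2 ^ 2 : ℝ) ≠ 0 := by
    intro h0
    have h1 : ((L.h i).1 : ℝ) = 0 := by nlinarith [sq_nonneg ((L.h i).1 : ℝ), sq_nonneg ((L.h i).2 : ℝ)]
    have h2 : ((L.h i).2 : ℝ) = 0 := by nlinarith [sq_nonneg ((L.h i).1 : ℝ), sq_nonneg ((L.h i).2 : ℝ)]
    exact L.h_ne_zero i (Prod.ext (by exact_mod_cast h1) (by exact_mod_cast h2))
  unfold lineCoord
  constructor
  · field_simp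
    linear_combination -((L.h i).2 : ℝ) * ha
  · field_simp
    linear_combination ((L.h i).1 : ℝ) * ha

theorem abs_sub_floor_le_one (t : ℝ) : |t - ⌊t⌋| ≤ 1 := by
  rw [abs_of_nonneg (by linarith [Int.floor_le t])]
  linarith [Int.lt_floor_add_one t]

theorem exists_taxiDist_round_le :
    ∃ C : ℝ, ∀ x, L.rbf.taxiDist x (L.toPoint (L.round x)) ≤ C := by
  obtain ⟨M, hM0, hM⟩ := L.exists_latticeNorm_h_le
  refine ⟨M + 2, fun x => ?_⟩
  cases x with
  | base b =>
    have h1 := EuclideanSpace.dist_le_abs_add_abs b (latticeVec (⌊b 0⌋, ⌊b 1⌋))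
    have h2 := abs_sub_floor_le_one (b 0)
    have h3 := abs_sub_floor_le_one (b 1)
    simp only [latticeVec_apply_zero, latticeVec_apply_one] at h1
    simp only [round, toPoint, RBFData.taxiDist, RBFData.proj, RBFData.sheet, RBFData.height,
      if_true, sub_self, abs_zero]
    linarith
  | wing i p a s hs =>
    obtain ⟨k, rfl⟩ : ∃ k, p = L.level i k := by
      obtain ⟨_, k, rfl⟩ := p
      exact ⟨k, rfl⟩
    have e1 : RBFData.Point.wing i (L.level i k) a s hs = L.rbf.halfFlat i (L.level i k) a s := by
      simp [RBFData.halfFlat, hs]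
    have e2 : ⌊(L.level i k : ℝ)⌋ = k := Int.floor_intCast k
    simp only [round, toPoint, e2, e1]
    rw [RBFData.taxiDist_halfFlat]
    obtain ⟨ha0, ha1⟩ := L.apply_eq_of_mem_hyperplane a.2
    have h1 : dist a (⟨_, L.latticeVec_foot_mem i k ⌊L.lineCoord i a⌋⟩ :
        L.rbf.hyperplane i (L.level i k)) ≤ M := by
      refine (EuclideanSpace.dist_le_abs_add_abs _ _).trans ?_
      have h2 := abs_sub_floor_le_one (L.lineCoord i a)
      refine le_trans (le_of_eq ?_) ((mul_le_of_le_one_left (latticeNorm_nonneg (L.h i)) h2).trans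
        (hM i))
      rw [latticeNorm, mul_add, ← abs_mul, ← abs_mul]
      congr 2
      · rw [latticeVec_apply_zero, ha0]
        simp [foot, quarterTurn, -Int.self_sub_floor]
        ring
      · rw [latticeVec_apply_one, ha1]
        simp [foot, quarterTurn, -Int.self_sub_floor]
        ring
    have h3 : |(s : ℝ) - ((⌊s⌋₊ : NNReal) : ℝ)| ≤ 1 := by
      have h4 : ((⌊s⌋₊ : NNReal) : ℝ) ≤ s := NNReal.coe_le_coe.2 (Nat.floor_le zero_le)
      have h5 : (s : ℝ) < ((⌊s⌋₊ : NNReal) : ℝ) + 1 := by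
        exact_mod_cast Nat.lt_floor_add_one s
      rw [abs_of_nonneg (by linarith)]
      linarith
    linarith

end BranchedLattice

/-! ### Comparison of the group distance with the flat distance on lattice points. -/

namespace BranchedLattice

open Multiplicative (ofAdd)
open LatticePoint

variable {G : Type*} [Group G] (L : BranchedLattice G) {S : Set G}

/-- The taxicab distance of two lattice points in the richly branching flat. -/
noncomputable def pointDist (x y : LatticePoint) : ℝ := L.rbf.taxiDist (L.toPoint x) (L.toPoint y)

/-- The word distance of two lattice points in the group. -/
noncomputable def groupDist (S : Set G) (x y : LatticePoint) : ℝ :=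
  wordDist S (L.toGroup x) (L.toGroup y)

/-- `x` does not lie on the wing `(i, k)`. -/
inductive OffWing (i : Fin 3) (k : ℤ) : LatticePoint → Prop
  | flat (z : ℤ × ℤ) : OffWing i k (.flat z)
  | wing (j : Fin 3) (l r : ℤ) (s : ℕ) : (j, l) ≠ (i, k) → OffWing i k (.wing j l r s)

/-- Every path in the group from a wing to a point elsewhere
passes near the line to which the wing is attached. -/
def Separated (S : Set G) : Prop :=
  ∃ R : ℝ, ∀ i k r s y, OffWing i k y → ∃ n : ℤ,
    L.groupDist S (wing i k r s) (flat (L.foot i k n)) + L.groupDist S (flat (L.foot i k n)) y ≤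
      L.groupDist S (wing i k r s) y + R

theorem pointDist_triangle (x y z : LatticePoint) :
    L.pointDist x z ≤ L.pointDist x y + L.pointDist y z :=
  L.rbf.taxiDist_triangle _ _ _

theorem pointDist_comm (x y : LatticePoint) : L.pointDist x y = L.pointDist y x :=
  L.rbf.taxiDist_comm _ _

theorem groupDist_comm (hS : Subgroup.closure S = ⊤) (x y : LatticePoint) :
    L.groupDist S x y = L.groupDist S y x :=
  wordDist_comm hS _ _

theorem groupDist_triangle (hS : Subgroup.closure S = ⊤) (x y z : LatticePoint) :
    L.groupDist S x z ≤ L.groupDist S x y + L.groupDist S y z :=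
  wordDist_triangle hS _ _ _

theorem toPoint_wing_zero (i : Fin 3) (k r : ℤ) :
    L.toPoint (wing i k r 0) = L.toPoint (flat (L.foot i k r)) := by
  simp only [toPoint, Nat.cast_zero]
  exact RBFData.halfFlat_zero _ _ _ _

/-- In the flat, row zero of a wing is the attaching line itself; in the group the two differ by
right multiplication by `τ i`, a bounded error. Powers of the relation `comm` move `τ i` past the
whole line. -/
theorem toGroup_wing_zero (i : Fin 3) (k r : ℤ) :
    L.toGroup (wing i k r 0) = L.toGroup (flat (L.foot i k r)) * L.τ i := by
  have h (r : ℤ) : L.φ (ofAdd (r • L.h i)) * L.τ i = L.τ i * L.ψ i (ofAdd (r • L.h' i)) := by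
    rw [ofAdd_zsmul, ofAdd_zsmul, map_zpow, map_zpow]
    exact (SemiconjBy.zpow_right (a := (L.τ i)) (x := L.ψ i (ofAdd (L.h' i)))
      (y := L.φ (ofAdd (L.h i))) (L.comm i).symm r).symm
  simp only [toGroup, foot, sideVec, Nat.cast_zero, zero_smul, add_zero, ofAdd_add, map_mul]
  rw [mul_assoc, mul_assoc, h]

theorem groupDist_flat (z w : ℤ × ℤ) :
    L.groupDist S (flat z) (flat w) = wordLength S (L.φ (ofAdd (w - z))) := by
  simp only [groupDist, toGroup, wordDist]
  rw [← map_inv, ← map_mul, ← ofAdd_neg, ← ofAdd_add, neg_add_eq_sub]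

theorem groupDist_wing (i : Fin 3) (k r r' : ℤ) (s s' : ℕ) :
    L.groupDist S (wing i k r s) (wing i k r' s') =
      wordLength S (L.ψ i (ofAdd (L.sideVec i (r' - r) (s' - s)))) := by
  have : L.sideVec i (r' - r) (s' - s) = L.sideVec i r' s' - L.sideVec i r s := by
    simp only [sideVec, sub_smul]
    abel
  rw [groupDist, toGroup, toGroup, wordDist_mul_left, wordDist, ← map_inv, ← map_mul, ← ofAdd_neg,
    ← ofAdd_add, neg_add_eq_sub, this]

theorem pointDist_flat (z w : ℤ × ℤ) :
    L.pointDist (flat z) (flat w) = dist (latticeVec z) (latticeVec w) := by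
  simp [pointDist, toPoint, RBFData.taxiDist, RBFData.proj, RBFData.sheet, RBFData.height]

theorem pointDist_wing (i : Fin 3) (k r r' : ℤ) (s s' : ℕ) :
    L.pointDist (wing i k r s) (wing i k r' s') =
      dist (latticeVec (L.foot i k r)) (latticeVec (L.foot i k r')) + |(s : ℝ) - s'| := by
  simp only [pointDist, toPoint]
  rw [RBFData.taxiDist_halfFlat]
  simp only [NNReal.coe_natCast]
  rfl

/-- Leaving a wing means descending to its foot, so the height adds exactly. Row zero needs separate
treatment because its points carry no sheet. -/
theorem pointDist_of_offWing {i : Fin 3} {k : ℤ} {y : LatticePoint} (hy : OffWing i k y) (r : ℤ)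
    (s : ℕ) :
    L.pointDist (wing i k r s) y = L.pointDist (flat (L.foot i k r)) y + s := by
  have h0 : ∀ y : L.rbf.Point, L.rbf.sheet y = none → L.rbf.height y = 0 := by
    intro y hy
    cases y with
    | base b => rfl
    | wing => simp [RBFData.sheet] at hy
  rcases Nat.eq_zero_or_pos s with rfl | hs
  · simp [pointDist, toPoint_wing_zero]
  · have hsheet : L.rbf.sheet (L.toPoint (wing i k r s)) = some ⟨i, L.level i k⟩ :=
      L.rbf.sheet_halfFlat _ (by exact_mod_cast hs)
    have hne : L.rbf.sheet (L.toPoint (wing i k r s)) ≠ L.rbf.sheet (L.toPoint y) := by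
      rw [hsheet]
      cases hy with
      | flat z => simp [toPoint, RBFData.sheet]
      | wing j l r' s' hjl =>
        rcases Nat.eq_zero_or_pos s' with rfl | hs'
        · rw [toPoint_wing_zero]
          simp [toPoint, RBFData.sheet]
        · have : L.rbf.sheet (L.toPoint (wing j l r' s')) = some ⟨j, L.level j l⟩ :=
            L.rbf.sheet_halfFlat _ (by exact_mod_cast hs')
          rw [this]
          intro h
          simp only [Option.some.injEq, Sigma.mk.injEq] at h
          obtain ⟨rfl, h⟩ := h
          have h2 := congrArg Subtype.val (eq_of_heq h)
          simp only [coe_level, Int.cast_inj] at h2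
          exact hjl (by rw [h2])
    have hproj : L.rbf.proj (L.toPoint (wing i k r s)) = latticeVec (L.foot i k r) :=
      L.rbf.proj_halfFlat _ _ _ _
    have hheight : L.rbf.height (L.toPoint (wing i k r s)) = s := by
      have := L.rbf.height_halfFlat i (L.level i k) ⟨_, L.latticeVec_foot_mem i k r⟩ s
      exact this.trans (NNReal.coe_natCast s)
    rw [pointDist, RBFData.taxiDist, if_neg hne, hproj, hheight]
    simp only [pointDist, RBFData.taxiDist]
    simp only [show L.toPoint (flat (L.foot i k r)) = .base (latticeVec (L.foot i k r)) from rfl,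
      RBFData.proj_base, RBFData.sheet_base, RBFData.height_base]
    split_ifs with h
    · rw [h0 _ h.symm]
      simp
    · ring

theorem exists_wordLength_τ_le (S : Set G) :
    ∃ T : ℝ, 0 ≤ T ∧ ∀ i, (wordLength S (L.τ i) : ℝ) ≤ T := by
  obtain ⟨T, hT⟩ := (Set.finite_range fun i => (wordLength S (L.τ i) : ℝ)).bddAbove
  exact ⟨T, (Nat.cast_nonneg _).trans (hT ⟨0, rfl⟩), fun i => hT ⟨i, rfl⟩⟩

theorem groupDist_wing_zero (i : Fin 3) (k r : ℤ) :
    L.groupDist S (flat (L.foot i k r)) (wing i k r 0) = wordLength S (L.τ i) := by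
  rw [groupDist, toGroup_wing_zero, wordDist_mul_right]

theorem latticeNorm_foot_sub (i : Fin 3) (k r r' : ℤ) :
    latticeNorm (L.foot i k r - L.foot i k r') = |(r : ℝ) - r'| * latticeNorm (L.h i) := by
  rw [foot, foot, add_sub_add_left_eq_sub, ← sub_smul, latticeNorm_zsmul]
  push_cast
  rfl

/-- Homomorphisms from ℤ² are Lipschitz, which settles two points on one piece. Other pairs are
joined through the feet of the wings, at the cost of one or two letters `τ i`. -/
theorem exists_groupDist_le (hS : Subgroup.closure S = ⊤) :
    ∃ A B : ℝ, 0 ≤ A ∧ ∀ x y, L.groupDist S x y ≤ A * L.pointDist x y + B := by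
  obtain ⟨K, hK0, hK⟩ := exists_wordLength_map_le hS L.φ
  obtain ⟨T, hT0, hT⟩ := L.exists_wordLength_τ_le S
  obtain ⟨M, hM0, hM⟩ : ∃ M : ℝ, 0 ≤ M ∧ ∀ i r s, (wordLength S (L.ψ i (ofAdd (L.sideVec i r s))) : ℝ)
      ≤ M * (|(r : ℝ)| + |(s : ℝ)|) := by
    choose K' hK'0 hK' using fun i => exists_wordLength_map_le hS (L.ψ i)
    obtain ⟨M, hM⟩ := (Set.finite_range fun i => K' i * latticeNorm (L.h' i)).bddAbove
    refine ⟨M, (mul_nonneg (hK'0 0) (latticeNorm_nonneg _)).trans (hM ⟨0, rfl⟩), fun i r s => ?_⟩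
    refine (hK' i _).trans ?_
    have h1 := latticeNorm_add_le (r • L.h' i) (s • quarterTurn (L.h' i))
    rw [latticeNorm_zsmul, latticeNorm_zsmul, latticeNorm_quarterTurn] at h1
    have h2 := mul_le_mul_of_nonneg_left h1 (hK'0 i)
    have h3 : K' i * latticeNorm (L.h' i) ≤ M := hM ⟨i, rfl⟩
    have h4 := mul_le_mul_of_nonneg_right h3 (by positivity : 0 ≤ |(r : ℝ)| + |(s : ℝ)|)
    unfold sideVec
    nlinarith
  -- `K` serves the flat and `M` the wings; the factor 2 covers the passage from the Euclidean to
  -- the ℓ¹ distance.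
  set A := 2 * K + 2 * M with hA
  have hA0 : 0 ≤ A := by positivity
  have hflat (z w : ℤ × ℤ) : L.groupDist S (flat z) (flat w) ≤ A * L.pointDist (flat z) (flat w) := by
    rw [groupDist_flat, pointDist_flat]
    have h1 := hK (w - z)
    have h2 := mul_le_mul_of_nonneg_left (latticeNorm_sub_le w z) hK0
    rw [dist_comm] at h2
    have h3 : 0 ≤ M * dist (latticeVec z) (latticeVec w) := by positivity
    rw [hA]
    linarith
  have hwing (i k r r' s s') :
      L.groupDist S (wing i k r s) (wing i k r' s') ≤
        A * L.pointDist (wing i k r s) (wing i k r' s') := by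
    rw [groupDist_wing, pointDist_wing]
    have h1 := hM i (r' - r) (s' - s)
    have h2 := latticeNorm_sub_le (L.foot i k r) (L.foot i k r')
    rw [latticeNorm_foot_sub] at h2
    have h3 := one_le_latticeNorm (L.h_ne_zero i)
    have h4 : |(r : ℝ) - r'| ≤ |(r : ℝ) - r'| * latticeNorm (L.h i) :=
      le_mul_of_one_le_right (abs_nonneg _) h3
    push_cast at h1
    rw [abs_sub_comm (r' : ℝ), abs_sub_comm (s' : ℝ)] at h1
    have h5 : M * (|(r : ℝ) - r'| + |(s : ℝ) - s'|) ≤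
        M * (2 * dist (latticeVec (L.foot i k r)) (latticeVec (L.foot i k r')) +
          2 * |(s : ℝ) - s'|) := by
      have := abs_nonneg ((s : ℝ) - s')
      gcongr <;> linarith
    have h6 : 0 ≤ K * (dist (latticeVec (L.foot i k r)) (latticeVec (L.foot i k r')) +
      |(s : ℝ) - s'|) := by positivity
    rw [hA]
    linarith
  have hdown (i k r s) : L.groupDist S (wing i k r s) (flat (L.foot i k r)) ≤ A * s + T := by
    have h1 := L.groupDist_triangle hS (wing i k r s) (wing i k r 0) (flat (L.foot i k r))
    have h2 := hwing i k r r s 0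
    rw [pointDist_wing] at h2
    rw [L.groupDist_comm hS (wing i k r 0), groupDist_wing_zero] at h1
    simp only [dist_self, Nat.cast_zero, sub_zero, zero_add, Nat.abs_cast] at h2
    linarith [hT i]
  have hflat_any (z y) : L.groupDist S (flat z) y ≤ A * L.pointDist (flat z) y + T := by
    cases y with
    | flat w => linarith [hflat z w]
    | wing i k r s =>
      have h1 := L.groupDist_triangle hS (wing i k r s) (flat (L.foot i k r)) (flat z)
      have h2 := hflat (L.foot i k r) z
      have h3 := hdown i k r s
      rw [L.groupDist_comm hS, L.pointDist_comm, L.pointDist_of_offWing (.flat z)]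
      linarith
  have hoff (i k r s y) (hy : OffWing i k y) :
      L.groupDist S (wing i k r s) y ≤ A * L.pointDist (wing i k r s) y + 2 * T := by
    have h1 := L.groupDist_triangle hS (wing i k r s) (flat (L.foot i k r)) y
    have h2 := hflat_any (L.foot i k r) y
    have h3 := hdown i k r s
    rw [L.pointDist_of_offWing hy]
    linarith
  refine ⟨A, 2 * T, hA0, fun x y => ?_⟩
  cases x with
  | flat z => linarith [hflat_any z y]
  | wing i k r s =>
    cases y with
    | flat w => exact hoff i k r s _ (.flat w)
    | wing j l r' s' =>
      by_cases h : (j, l) = (i, k)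
      · obtain ⟨rfl, rfl⟩ := Prod.mk.inj h
        linarith [hwing j l r r' s s']
      · exact hoff i k r s _ (.wing j l r' s' h)

/-- Undistortion gives the bound on each piece. Separation cuts a distance between different pieces
at a point of the attaching line, and the bounds for the two parts add up. -/
theorem exists_pointDist_le (hS : Subgroup.closure S = ⊤) (hφ : GrowsLinearly S L.φ)
    (hψ : ∀ i, GrowsLinearly S (L.ψ i)) (hsep : L.Separated S) :
    ∃ A B : ℝ, 0 ≤ A ∧ ∀ x y, L.pointDist x y ≤ A * L.groupDist S x y + B := by
  obtain ⟨A₁, B₁, hA₁, h₁⟩ := hφ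
  choose A₂ B₂ hA₂ h₂ using hψ
  obtain ⟨T, hT0, hT⟩ := L.exists_wordLength_τ_le S
  obtain ⟨M, hM0, hM⟩ := L.exists_latticeNorm_h_le
  obtain ⟨R, hR⟩ := hsep
  obtain ⟨A₃, hA₃⟩ := (Set.finite_range A₂).bddAbove
  obtain ⟨B₃, hB₃⟩ := (Set.finite_range B₂).bddAbove
  have hA₃0 : 0 ≤ A₃ := (hA₂ 0).trans (hA₃ ⟨0, rfl⟩)
  -- `A₁` serves the flat. On a wing, `2 * A₃` bounds the coordinate differences, and `M + 1`
  -- converts these into distance: at most `M` per unit along the line and 1 per unit of height.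
  set A := A₁ + (M + 1) * (2 * A₃) with hA
  set B := |B₁| + (M + 1) * (2 * |B₃|) with hB
  have hA0 : 0 ≤ A := by positivity
  have hB0 : 0 ≤ B := by positivity
  have hflat (z w : ℤ × ℤ) :
      L.pointDist (flat z) (flat w) ≤ A * L.groupDist S (flat z) (flat w) + B := by
    rw [groupDist_flat, pointDist_flat, dist_comm]
    have h1 := h₁ (w - z)
    have h2 := dist_latticeVec_le w z
    have h3 : 0 ≤ (M + 1) * (2 * A₃) * wordLength S (L.φ (ofAdd (w - z))) := by positivity
    have h4 : 0 ≤ (M + 1) * (2 * |B₃|) := by positivity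
    rw [hA, hB]
    linarith [le_abs_self B₁]
  have hwing (i k r r' s s') :
      L.pointDist (wing i k r s) (wing i k r' s') ≤
        A * L.groupDist S (wing i k r s) (wing i k r' s') + B := by
    rw [groupDist_wing, pointDist_wing]
    set n : ℝ := (wordLength S (L.ψ i (ofAdd (L.sideVec i (r' - r) (s' - s)))) : ℝ) with hn
    have hn0 : 0 ≤ n := Nat.cast_nonneg _
    have h1 : latticeNorm (L.sideVec i (r' - r) (s' - s)) ≤ A₂ i * n + B₂ i := h₂ i _
    clear_value n
    have h2 := abs_add_abs_le_latticeNorm (L.h'_ne_zero i) (r' - r) (s' - s)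
    have h3 := dist_latticeVec_le (L.foot i k r) (L.foot i k r')
    rw [latticeNorm_foot_sub] at h3
    push_cast at h2
    rw [abs_sub_comm (r' : ℝ), abs_sub_comm (s' : ℝ)] at h2
    have h4 : |(r : ℝ) - r'| * latticeNorm (L.h i) ≤ |(r : ℝ) - r'| * M := by
      gcongr
      exact hM i
    have h5 : A₂ i * n ≤ A₃ * n := by
      gcongr
      exact hA₃ ⟨i, rfl⟩
    have h6 : B₂ i ≤ |B₃| := (hB₃ ⟨i, rfl⟩).trans (le_abs_self _)
    have h7 : |(r : ℝ) - r'| + |(s : ℝ) - s'| ≤ 2 * (A₃ * n + |B₃|) := by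
      refine h2.trans ?_
      unfold sideVec at h1
      linarith
    have h8 := mul_le_mul_of_nonneg_left h7 (by positivity : 0 ≤ M + 1)
    have h9 : 0 ≤ M * |(s : ℝ) - s'| := by positivity
    have h10 : 0 ≤ A₁ * n := by positivity
    have h11 := abs_nonneg ((r : ℝ) - r')
    have h12 := abs_nonneg B₁
    rw [hA, hB]
    linarith
  -- A point of the attaching line is replaced by the point of row zero above it: the same point of
  -- the flat, and at distance at most `T` in the group.
  have hedge (i k r s n) : L.pointDist (wing i k r s) (flat (L.foot i k n)) ≤
      A * L.groupDist S (wing i k r s) (flat (L.foot i k n)) + (A * T + B) := by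
    have h1 := hwing i k r n s 0
    have h2 := L.groupDist_triangle hS (wing i k r s) (flat (L.foot i k n)) (wing i k n 0)
    rw [groupDist_wing_zero] at h2
    have h3 : L.pointDist (wing i k r s) (wing i k n 0) =
        L.pointDist (wing i k r s) (flat (L.foot i k n)) := by
      rw [pointDist, toPoint_wing_zero, pointDist]
    have h4 := mul_le_mul_of_nonneg_left (h2.trans (add_le_add_right (hT i) _)) hA0
    rw [h3] at h1
    linarith
  -- A bound from the flat to `y` is promoted to a bound from a wing to `y`. This is used twice:
  -- with `y` in the flat, which settles all pairs with one point in the flat, and then with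
  -- arbitrary `y` off the wing.
  have hoff (i k r s y) (hy : OffWing i k y) {C : ℝ} (hC : ∀ z, L.pointDist (flat z) y ≤
      A * L.groupDist S (flat z) y + C) : L.pointDist (wing i k r s) y ≤
        A * L.groupDist S (wing i k r s) y + (A * R + (A * T + B) + C) := by
    obtain ⟨n, hn⟩ := hR i k r s y hy
    have h1 := hedge i k r s n
    have h2 := hC (L.foot i k n)
    have h3 := L.pointDist_triangle (wing i k r s) (flat (L.foot i k n)) y
    have h4 := mul_le_mul_of_nonneg_left hn hA0
    linarith
  set C := |A * R + (A * T + B) + B| with hC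
  have hC0 : 0 ≤ C := abs_nonneg _
  have hflat_any (z y) : L.pointDist (flat z) y ≤ A * L.groupDist S (flat z) y + (B + C) := by
    cases y with
    | flat w => linarith [hflat z w]
    | wing i k r s =>
      have := hoff i k r s (flat z) (.flat z) fun w => hflat w z
      rw [L.pointDist_comm, L.groupDist_comm hS]
      linarith [le_abs_self (A * R + (A * T + B) + B)]
  have hoff_any (i k r s y) (hy : OffWing i k y) := hoff i k r s y hy (hflat_any · y)
  refine ⟨A, B + C + |A * R + (A * T + B) + (B + C)|, hA0, fun x y => ?_⟩
  have hlast := abs_nonneg (A * R + (A * T + B) + (B + C))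
  have hlast' := le_abs_self (A * R + (A * T + B) + (B + C))
  cases x with
  | flat z => linarith [hflat_any z y]
  | wing i k r s =>
    cases y with
    | flat w => linarith [hoff_any i k r s _ (.flat w)]
    | wing j l r' s' =>
      by_cases h : (j, l) = (i, k)
      · obtain ⟨rfl, rfl⟩ := Prod.mk.inj h
        linarith [hwing j l r r' s s']
      · linarith [hoff_any i k r s _ (.wing j l r' s' h)]

/-- The richly branching flat of a separated branched lattice with undistorted pieces is
quasiisometrically embedded. -/
theorem isQIEmbedding (hS : Subgroup.closure S = ⊤) (hφ : GrowsLinearly S L.φ)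
    (hψ : ∀ i, GrowsLinearly S (L.ψ i)) (hsep : L.Separated S) :
    IsQIEmbedding L.rbf.pathDist (wordDist S) fun x => L.toGroup (L.round x) := by
  obtain ⟨A, B, hA, h1⟩ := L.exists_groupDist_le hS
  obtain ⟨A', B', hA', h2⟩ := L.exists_pointDist_le hS hφ hψ hsep
  obtain ⟨C, hC⟩ := L.exists_taxiDist_round_le
  refine L.rbf.isQIEmbedding_of_taxiDist (K := A + A') (C := |B + A * (2 * C)| + |B' + 2 * C|)
    (by positivity) wordDist_nonneg (fun x y => ?_) fun x y => ?_
  · have h := h2 (L.round x) (L.round y)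
    have t1 := L.rbf.taxiDist_triangle x (L.toPoint (L.round x)) y
    have t2 := L.rbf.taxiDist_triangle (L.toPoint (L.round x)) (L.toPoint (L.round y)) y
    rw [L.rbf.taxiDist_comm (L.toPoint (L.round y))] at t2
    have h0 : 0 ≤ A * L.groupDist S (L.round x) (L.round y) :=
      mul_nonneg hA (wordDist_nonneg _ _)
    have h3 := abs_nonneg (B + A * (2 * C))
    have h4 := le_abs_self (B' + 2 * C)
    simp only [pointDist, groupDist] at h h0
    linarith [hC x, hC y]
  · have h := h1 (L.round x) (L.round y)
    have t1 := L.rbf.taxiDist_triangle (L.toPoint (L.round x)) x (L.toPoint (L.round y))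
    have t2 := L.rbf.taxiDist_triangle x y (L.toPoint (L.round y))
    rw [L.rbf.taxiDist_comm _ x] at t1
    have t3 : L.pointDist (L.round x) (L.round y) ≤ L.rbf.taxiDist x y + 2 * C := by
      unfold pointDist
      linarith [hC x, hC y]
    have t4 := mul_le_mul_of_nonneg_left t3 hA
    have h0 : 0 ≤ A' * L.rbf.taxiDist x y := by
      refine mul_nonneg hA' ?_
      have := L.rbf.taxiDist_triangle x y x
      rw [L.rbf.taxiDist_self, L.rbf.taxiDist_comm y x] at this
      linarith
    have h3 := abs_nonneg (B' + 2 * C)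
    have h4 := le_abs_self (B + A * (2 * C))
    simp only [groupDist] at h
    linarith

end BranchedLattice

/-! ### Affine actions of the fundamental group of a graph of groups -/

namespace GraphOfGroups

variable {V : Type u₁} {E : Type u₂} (𝒢 : GraphOfGroups.{u₁, u₂, u₃, u₄} V E) (T : Set E)

/-- The stable letter of `e` in the fundamental group. -/
def stableLetter (e : E) : 𝒢.FundamentalGroup T := QuotientGroup.mk (𝒢.stable e)

/-- The homomorphism of an edge group into the fundamental group by way of one of its ends. -/
def edgeHom (e : E) (b : Bool) : 𝒢.edgeGroup e →* 𝒢.FundamentalGroup T :=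
  (𝒢.vertexHom T (𝒢.endpoint e b)).comp (𝒢.incl e b)

/-- The element that leads along the edge `e` to its end `b` from its other end. -/
def transit (e : E) : Bool → 𝒢.FundamentalGroup T
  | true => 𝒢.stableLetter T e
  | false => (𝒢.stableLetter T e)⁻¹

theorem mk_eq_one_of_mem_relators {r : 𝒢.FreeProd} (hr : r ∈ 𝒢.relators T) :
    (QuotientGroup.mk r : 𝒢.FundamentalGroup T) = 1 :=
  (QuotientGroup.eq_one_iff r).2 (Subgroup.subset_normalClosure hr)

theorem stableLetter_eq_one {e : E} (he : e ∈ T) : 𝒢.stableLetter T e = 1 :=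
  𝒢.mk_eq_one_of_mem_relators T (.inr ⟨e, he, rfl⟩)

theorem stableLetter_mul_edgeHom (e : E) (g : 𝒢.edgeGroup e) :
    𝒢.stableLetter T e * 𝒢.edgeHom T e false g = 𝒢.edgeHom T e true g * 𝒢.stableLetter T e := by
  have := 𝒢.mk_eq_one_of_mem_relators T (.inl ⟨e, g, rfl⟩)
  rw [QuotientGroup.mk_mul, QuotientGroup.mk_mul, QuotientGroup.mk_mul, QuotientGroup.mk_inv,
    QuotientGroup.mk_inv, mul_inv_eq_one, mul_inv_eq_iff_eq_mul] at this
  exact this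

/-- This supplies the relation `comm` of the branched lattice, for either orientation of the edge.
-/
theorem edgeHom_mul_transit (e : E) (b : Bool) (g : 𝒢.edgeGroup e) :
    𝒢.edgeHom T e b g * 𝒢.transit T e b = 𝒢.transit T e b * 𝒢.edgeHom T e (!b) g := by
  have := 𝒢.stableLetter_mul_edgeHom T e g
  cases b
  · simp only [transit, Bool.not_false]
    rw [mul_inv_eq_iff_eq_mul, mul_assoc, ← this, inv_mul_cancel_left]
  · exact this.symm

variable {T} in
/-- An edge defines an integer potential on the vertices that changes along no other edge of the
spanning tree. -/
theorem IsSpanningTree.exists_potential (hT : 𝒢.IsSpanningTree T) (e : E) :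
    ∃ σ : V → ℤ, (∀ e' ∈ T, e' ≠ e → σ (𝒢.endpoint e' false) = σ (𝒢.endpoint e' true)) ∧
      (e ∈ T → σ (𝒢.endpoint e false) = σ (𝒢.endpoint e true) + 1) := by
  classical
  by_cases he : e ∈ T
  -- Without `e` the tree falls apart, with the ends of `e` in different components; the potential
  -- is the indicator of the component of the `false` end.
  · refine ⟨fun u => if 𝒢.Joined (T \ {e}) (𝒢.endpoint e false) u then 1 else 0,
      fun e' he' hne => ?_, fun _ => ?_⟩
    · have h : 𝒢.Joined (T \ {e}) (𝒢.endpoint e' false) (𝒢.endpoint e' true) :=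
        .rel _ _ ⟨e', ⟨he', hne⟩, rfl, rfl⟩
      have : 𝒢.Joined (T \ {e}) (𝒢.endpoint e false) (𝒢.endpoint e' false) ↔
          𝒢.Joined (T \ {e}) (𝒢.endpoint e false) (𝒢.endpoint e' true) :=
        ⟨fun h' => .trans _ _ _ h' h, fun h' => .trans _ _ _ h' (.symm _ _ h)⟩
      simp only [this]
    · simp only [if_neg (hT.acyclic e he)]
      rw [if_pos (.refl _)]
      rfl
  · exact ⟨fun _ => 0, fun _ _ _ => rfl, fun h => absurd h he⟩

/-- The permutation module on the cosets of the image of the edge group of `e`. -/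
abbrev EdgeModule (e : E) : Type _ := (𝒢.FundamentalGroup T ⧸ (𝒢.edgeHom T e true).range) →₀ ℤ

/-! ### The permutation module of an edge and the affine action on it. -/

namespace EdgeModule

variable {𝒢 T} {e : E}

/-- The linear action of the fundamental group on the permutation module of an edge. -/
noncomputable def lin (g : 𝒢.FundamentalGroup T) : 𝒢.EdgeModule T e ≃+ 𝒢.EdgeModule T e :=
  Finsupp.domCongr (MulAction.toPerm g)

theorem lin_apply (g : 𝒢.FundamentalGroup T) (m : 𝒢.EdgeModule T e)
    (q : 𝒢.FundamentalGroup T ⧸ (𝒢.edgeHom T e true).range) : lin g m q = m (g⁻¹ • q) := rfl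

theorem lin_single (g x : 𝒢.FundamentalGroup T) (n : ℤ) :
    lin g (Finsupp.single (x : 𝒢.FundamentalGroup T ⧸ (𝒢.edgeHom T e true).range) n) =
      Finsupp.single (↑(g * x)) n :=
  Finsupp.equivMapDomain_single _ _ _

/-- The linear action as a homomorphism into the permutation group. -/
noncomputable def linHom : 𝒢.FundamentalGroup T →* Equiv.Perm (𝒢.EdgeModule T e) where
  toFun g := (lin g).toEquiv
  map_one' := by
    ext m q
    change lin 1 m q = m q
    rw [lin_apply, inv_one, one_smul]
  map_mul' g h := by
    ext m q
    change lin (g * h) m q = lin g (lin h m) q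
    rw [lin_apply, lin_apply, lin_apply, mul_inv_rev, mul_smul]

theorem linHom_apply (g : 𝒢.FundamentalGroup T) (m : 𝒢.EdgeModule T e) :
    linHom g m = lin g m := rfl

/-- The coset of the neutral element. -/
noncomputable def origin : 𝒢.EdgeModule T e :=
  Finsupp.single ((1 : 𝒢.FundamentalGroup T) : 𝒢.FundamentalGroup T ⧸ (𝒢.edgeHom T e true).range) 1

theorem lin_edgeHom_origin (g : 𝒢.edgeGroup e) :
    lin (𝒢.edgeHom T e true g) origin = (origin : 𝒢.EdgeModule T e) := by
  rw [origin, lin_single, mul_one]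
  congr 1
  rw [QuotientGroup.eq]
  simp

variable (σ : V → ℤ)

/-- The base point of a vertex for a given potential. -/
noncomputable def basePoint (u : V) : 𝒢.EdgeModule T e := σ u • origin

/-- A vertex group acts linearly around the base point of the vertex. -/
noncomputable def vertexPerm (u : V) : 𝒢.vertexGroup u →* Equiv.Perm (𝒢.EdgeModule T e) :=
  (MulAut.conj (Equiv.addRight (basePoint σ u))).toMonoidHom.comp (linHom.comp (𝒢.vertexHom T u))

theorem vertexPerm_apply (u : V) (g : 𝒢.vertexGroup u) (m : 𝒢.EdgeModule T e) :
    vertexPerm σ u g m = lin (𝒢.vertexHom T u g) (m - basePoint σ u) + basePoint σ u := by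
  simp [vertexPerm, linHom_apply, sub_eq_add_neg]

open Classical in
/-- The vector by which the stable letter of `e'` misses the base points of the ends of `e'`. -/
noncomputable def defect (e' : E) : 𝒢.EdgeModule T e := if e' = e then origin else 0

/-- A stable letter acts by an affine map that takes the base point at its one end to the base
point at the other, up to the defect. -/
noncomputable def stablePerm (e' : E) : Equiv.Perm (𝒢.EdgeModule T e) :=
  Equiv.addRight (basePoint σ (𝒢.endpoint e' true) + defect e') * linHom (𝒢.stableLetter T e') *
    Equiv.addRight (-basePoint σ (𝒢.endpoint e' false))

theorem stablePerm_apply (e' : E) (m : 𝒢.EdgeModule T e) :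
    stablePerm σ e' m = lin (𝒢.stableLetter T e') (m - basePoint σ (𝒢.endpoint e' false)) +
      (basePoint σ (𝒢.endpoint e' true) + defect e') := by
  simp [stablePerm, linHom_apply, sub_eq_add_neg]

/-- The action of the free product. -/
noncomputable def freeAction : 𝒢.FreeProd →* Equiv.Perm (𝒢.EdgeModule T e) :=
  Monoid.Coprod.lift (Monoid.CoprodI.lift (vertexPerm σ)) (FreeGroup.lift (stablePerm σ))

theorem freeAction_ofVertex (u : V) (g : 𝒢.vertexGroup u) :
    freeAction σ (𝒢.ofVertex u g) = (vertexPerm σ u g : Equiv.Perm (𝒢.EdgeModule T e)) := by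
  simp [freeAction, ofVertex]

theorem freeAction_stable (e' : E) :
    freeAction σ (𝒢.stable e') = (stablePerm σ e' : Equiv.Perm (𝒢.EdgeModule T e)) := by
  simp [freeAction, stable]

theorem lin_defect (e' : E) (g : 𝒢.edgeGroup e') :
    lin (𝒢.edgeHom T e' true g) (defect e') = (defect e' : 𝒢.EdgeModule T e) := by
  unfold defect
  split_ifs with h
  · subst h
    exact lin_edgeHom_origin g
  · exact map_zero _

theorem lin_mul (g h : 𝒢.FundamentalGroup T) (m : 𝒢.EdgeModule T e) :
    lin (g * h) m = lin g (lin h m) :=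
  DFunLike.congr_fun (linHom.map_mul g h) m

theorem lin_one (m : 𝒢.EdgeModule T e) : lin 1 m = m :=
  DFunLike.congr_fun linHom.map_one m

variable {σ}

/-- The edge relators hold because the edge group fixes the defect: `origin` is its own coset. The
tree relators hold because the drop of the potential along `e` cancels the defect. -/
theorem freeAction_eq_one_of_mem_relators
    (hσ : ∀ e' ∈ T, e' ≠ e → σ (𝒢.endpoint e' false) = σ (𝒢.endpoint e' true))
    (hσe : e ∈ T → σ (𝒢.endpoint e false) = σ (𝒢.endpoint e true) + 1)
    {r : 𝒢.FreeProd} (hr : r ∈ 𝒢.relators T) :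
    freeAction σ r = (1 : Equiv.Perm (𝒢.EdgeModule T e)) := by
  rcases hr with ⟨e', g, rfl⟩ | ⟨e', he', rfl⟩
  · rw [map_mul, map_mul, map_mul, map_inv, map_inv, mul_inv_eq_one, mul_inv_eq_iff_eq_mul,
      freeAction_stable, freeAction_ofVertex, freeAction_ofVertex]
    ext1 m
    rw [Equiv.Perm.mul_apply, Equiv.Perm.mul_apply, stablePerm_apply, vertexPerm_apply,
      vertexPerm_apply, stablePerm_apply, add_sub_cancel_right, ← lin_mul]
    have h := 𝒢.stableLetter_mul_edgeHom T e' g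
    simp only [edgeHom, MonoidHom.comp_apply] at h
    have h' := lin_defect (𝒢 := 𝒢) (T := T) (e := e) e' g
    simp only [edgeHom, MonoidHom.comp_apply] at h'
    rw [h, lin_mul]
    simp only [map_sub, map_add, h']
    abel
  · rw [freeAction_stable]
    ext1 m
    rw [stablePerm_apply, 𝒢.stableLetter_eq_one T he', lin_one, Equiv.Perm.one_apply]
    unfold basePoint defect
    split_ifs with h
    · subst h
      rw [hσe he', add_smul, one_smul, sub_add_cancel]
    · rw [hσ e' he' h, add_zero, sub_add_cancel]

end EdgeModule

variable {T} in
open EdgeModule in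
/-- An affine action of the fundamental group on the permutation module of an edge, in which the
vertex groups fix points, and adjacent cosets of vertex groups have the same fixed point unless
they are joined by a translate of the given edge. -/
theorem IsSpanningTree.exists_affineAction (hT : 𝒢.IsSpanningTree T) (e : E) :
    ∃ (act : 𝒢.FundamentalGroup T →* Equiv.Perm (𝒢.EdgeModule T e)) (p : V → 𝒢.EdgeModule T e),
      (∀ g m m', act g (m + m') = act g m + lin g m') ∧
      (∀ u g, act (𝒢.vertexHom T u g) (p u) = p u) ∧
      ∀ e', act (𝒢.stableLetter T e') (p (𝒢.endpoint e' false)) =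
        p (𝒢.endpoint e' true) + defect e' := by
  obtain ⟨σ, hσ, hσe⟩ := hT.exists_potential 𝒢 e
  have hker : Subgroup.normalClosure (𝒢.relators T) ≤
      (freeAction σ : 𝒢.FreeProd →* Equiv.Perm (𝒢.EdgeModule T e)).ker :=
    Subgroup.normalClosure_le_normal fun r hr => freeAction_eq_one_of_mem_relators hσ hσe hr
  set act : 𝒢.FundamentalGroup T →* Equiv.Perm (𝒢.EdgeModule T e) :=
    QuotientGroup.lift _ (freeAction σ) hker with hact
  have hv (u : V) (g : 𝒢.vertexGroup u) : act (𝒢.vertexHom T u g) = vertexPerm σ u g :=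
    freeAction_ofVertex σ u g
  have hs (e' : E) : act (𝒢.stableLetter T e') = stablePerm σ e' := freeAction_stable σ e'
  refine ⟨act, basePoint σ, ?_, fun u g => ?_, fun e' => ?_⟩
  -- The elements whose action has linear part `lin` form a subgroup, so the generators suffice.
  · let P : Subgroup (𝒢.FundamentalGroup T) :=
      { carrier := {g | ∀ m m', act g (m + m') = act g m + lin g m'}
        one_mem' := fun m m' => by rw [map_one, lin_one]; rfl
        mul_mem' := fun {a b} ha hb m m' => by
          rw [map_mul, Equiv.Perm.mul_apply, Equiv.Perm.mul_apply, hb, ha, lin_mul]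
        inv_mem' := fun {a} ha m m' => by
          apply (act a).injective
          rw [ha, ← Equiv.Perm.mul_apply, ← Equiv.Perm.mul_apply, ← map_mul, mul_inv_cancel,
            map_one, ← lin_mul, mul_inv_cancel, lin_one]
          rfl }
    suffices h : ∀ x : 𝒢.FreeProd, (QuotientGroup.mk x : 𝒢.FundamentalGroup T) ∈ P by
      intro g
      obtain ⟨x, rfl⟩ := QuotientGroup.mk_surjective g
      exact h x
    have hvP (u : V) (g : 𝒢.vertexGroup u) : 𝒢.vertexHom T u g ∈ P := fun m m' => by
      rw [hv, vertexPerm_apply, vertexPerm_apply, add_sub_right_comm, map_add]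
      abel
    have hsP (e' : E) : 𝒢.stableLetter T e' ∈ P := fun m m' => by
      rw [hs, stablePerm_apply, stablePerm_apply, add_sub_right_comm, map_add]
      abel
    intro x
    induction x using Monoid.Coprod.induction_on with
    | inl x =>
      induction x using Monoid.CoprodI.induction_on with
      | one =>
        rw [map_one]
        exact P.one_mem
      | of u g => exact hvP u g
      | mul x y hx hy =>
        rw [map_mul, QuotientGroup.mk_mul]
        exact P.mul_mem hx hy
    | inr x =>
      induction x using FreeGroup.induction_on with
      | C1 =>
        rw [map_one]
        exact P.one_mem
      | of e' => exact hsP e'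
      | inv_of e' h =>
        rw [map_inv, QuotientGroup.mk_inv]
        exact P.inv_mem h
      | mul x y hx hy =>
        rw [map_mul, QuotientGroup.mk_mul]
        exact P.mul_mem hx hy
    | mul x y hx hy =>
      rw [QuotientGroup.mk_mul]
      exact P.mul_mem hx hy
  · rw [hv, vertexPerm_apply, sub_self, map_zero, zero_add]
  · rw [hs, stablePerm_apply, sub_self, map_zero, zero_add]

end GraphOfGroups

/-! ### Commensurable cyclic subgroups -/

theorem Subgroup.relIndex_zpowers_zpow_ne_zero {G : Type*} [Group G] (y : G) {n : ℤ} (hn : n ≠ 0) :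
    (Subgroup.zpowers (y ^ n)).relIndex (Subgroup.zpowers y) ≠ 0 := by
  have h1 : Subgroup.zpowers y = (⊤ : Subgroup (Multiplicative ℤ)).map (zpowersHom G y) := by
    rw [← MonoidHom.range_eq_map]
    rfl
  have h2 : Subgroup.zpowers (y ^ n) =
      (Subgroup.zpowers (Multiplicative.ofAdd n)).map (zpowersHom G y) := by
    rw [MonoidHom.map_zpowers]
    simp
  have h3 : (Subgroup.zpowers (Multiplicative.ofAdd n)).index ≠ 0 := by
    have h : (Subgroup.zpowers (Multiplicative.ofAdd n)).index = n.natAbs := Int.index_zmultiples n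
    rw [h]
    exact Int.natAbs_ne_zero.2 hn
  rw [h1, h2, Subgroup.relIndex_map_map, top_sup_eq, Subgroup.relIndex_top_right]
  exact fun h0 => h3 (Nat.eq_zero_of_zero_dvd (h0 ▸ Subgroup.index_dvd_of_le le_sup_left))

/-- The common power generates a subgroup of finite index in both cyclic groups. -/
theorem Subgroup.commensurable_zpowers {G : Type*} [Group G] {x y : G} {m n : ℤ} (hm : m ≠ 0)
    (hn : n ≠ 0) (h : x ^ m = y ^ n) :
    Subgroup.Commensurable (Subgroup.zpowers x) (Subgroup.zpowers y) := by
  constructor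
  · have hle : Subgroup.zpowers (y ^ n) ≤ Subgroup.zpowers x := by
      rw [Subgroup.zpowers_le, ← h]
      exact Subgroup.zpow_mem _ (Subgroup.mem_zpowers x) m
    exact fun h0 => Subgroup.relIndex_zpowers_zpow_ne_zero y hn
      (Nat.eq_zero_of_zero_dvd (h0 ▸ Subgroup.relIndex_dvd_of_le_left _ hle))
  · have hle : Subgroup.zpowers (x ^ m) ≤ Subgroup.zpowers y := by
      rw [Subgroup.zpowers_le, h]
      exact Subgroup.zpow_mem _ (Subgroup.mem_zpowers y) n
    exact fun h0 => Subgroup.relIndex_zpowers_zpow_ne_zero x hm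
      (Nat.eq_zero_of_zero_dvd (h0 ▸ Subgroup.relIndex_dvd_of_le_left _ hle))

theorem exists_zsmul_eq_zsmul {z w : ℤ × ℤ} (hz : z ≠ 0) (hw : w ≠ 0)
    (h : z.1 * w.2 = z.2 * w.1) : ∃ m n : ℤ, m ≠ 0 ∧ n ≠ 0 ∧ m • z = n • w := by
  obtain ⟨a, b⟩ := z
  obtain ⟨c, d⟩ := w
  simp only [ne_eq, Prod.mk_eq_zero, not_and] at hz hw h
  by_cases ha : a = 0
  · subst ha
    have hb := hz rfl
    have hc : c = 0 := by simpa [hb] using h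
    exact ⟨d, b, hw hc, hb, by simp [hc, mul_comm]⟩
  · have hc : c ≠ 0 := by
      rintro rfl
      simp [ha] at h
      exact hw rfl h
    refine ⟨c, a, hc, ha, ?_⟩
    simp only [Prod.smul_mk, smul_eq_mul, Prod.mk.injEq]
    exact ⟨mul_comm _ _, by linarith⟩

/-! ### Separation by edges -/

namespace GraphOfGroups

variable {V : Type u₁} {E : Type u₂} (𝒢 : GraphOfGroups.{u₁, u₂, u₃, u₄} V E) (T : Set E)

open EdgeModule

/-- A path in the fundamental group along which a coordinate of the affine action changes passes
near the corresponding coset of the edge group. -/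
theorem exists_near_coset [Finite V] {S : Set (𝒢.FundamentalGroup T)} (hS : IsFiniteGenerating S)
    {e : E} (act : 𝒢.FundamentalGroup T →* Equiv.Perm (𝒢.EdgeModule T e)) (p : V → 𝒢.EdgeModule T e)
    (hact : ∀ g m m', act g (m + m') = act g m + lin g m') :
    ∃ R : ℝ, ∀ (γ x y : 𝒢.FundamentalGroup T) (u w : V),
      act x (p u) (QuotientGroup.mk γ) ≠ act y (p w) (QuotientGroup.mk γ) →
      ∃ c ∈ (𝒢.edgeHom T e true).range,
        wordDist S x (γ * c) + wordDist S (γ * c) y ≤ wordDist S x y + R := by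
  -- All displacements that can occur: those of base points by a generator, and those from one base
  -- point to another. They are finitely many, with finite supports.
  let D : Set (𝒢.EdgeModule T e) :=
    (fun a : 𝒢.FundamentalGroup T × V => act a.1 (p a.2) - p a.2) '' ((S ∪ S⁻¹) ×ˢ Set.univ) ∪
      Set.range fun a : V × V => p a.1 - p a.2
  have hD : D.Finite :=
    (((hS.1.union hS.1.inv).prod Set.finite_univ).image _).union (Set.finite_range _)
  have hD' : (⋃ m ∈ D, (m.support : Set (_ ⧸ (𝒢.edgeHom T e true).range))).Finite :=
    hD.biUnion fun m _ => m.support.finite_toSet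
  obtain ⟨R, hR⟩ := (hD'.image fun q => (wordLength S q.out : ℝ)).bddAbove
  -- A nonzero coordinate of `lin z m` at the coset of `γ` puts the coset of `z⁻¹ * γ` in the
  -- support of `m`; the chosen representative of that coset has length at most `R`.
  have hnear : ∀ (γ z : 𝒢.FundamentalGroup T), ∀ m ∈ D, lin z m (QuotientGroup.mk γ) ≠ 0 →
      ∃ c ∈ (𝒢.edgeHom T e true).range, wordDist S z (γ * c) ≤ R := by
    intro γ z m hm hne
    obtain ⟨c, hc⟩ := QuotientGroup.mk_out_eq_mul (𝒢.edgeHom T e true).range (z⁻¹ * γ)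
    refine ⟨c, c.2, ?_⟩
    have := hR (Set.mem_image_of_mem _ (Set.mem_biUnion hm (Finsupp.mem_support_iff.2 hne)))
    rw [wordDist, ← mul_assoc, ← hc]
    exact this
  -- At the first letter that changes the coordinate, the displacement by that letter has a nonzero
  -- entry there.
  have hwalk : ∀ (γ : 𝒢.FundamentalGroup T) (u : V) (l : List (𝒢.FundamentalGroup T))
      (x : 𝒢.FundamentalGroup T), (∀ s ∈ l, s ∈ S ∨ s⁻¹ ∈ S) →
      act x (p u) (QuotientGroup.mk γ) ≠ act (x * l.prod) (p u) (QuotientGroup.mk γ) →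
      ∃ l₁ l₂ : List (𝒢.FundamentalGroup T), l = l₁ ++ l₂ ∧
        ∃ c ∈ (𝒢.edgeHom T e true).range, wordDist S (x * l₁.prod) (γ * c) ≤ R := by
    intro γ u l
    induction l with
    | nil => intro x _ h; simp at h
    | cons s l ih =>
      intro x hl h
      by_cases hs : act x (p u) (QuotientGroup.mk γ) = act (x * s) (p u) (QuotientGroup.mk γ)
      · rw [hs, List.prod_cons, ← mul_assoc] at h
        obtain ⟨l₁, l₂, rfl, c, hc, hcR⟩ := ih (x * s) (fun s' hs' => hl s' (by simp [hs'])) h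
        exact ⟨s :: l₁, l₂, rfl, c, hc, by rwa [List.prod_cons, ← mul_assoc]⟩
      · refine ⟨[], s :: l, rfl, ?_⟩
        rw [List.prod_nil, mul_one]
        refine hnear γ x (act s (p u) - p u)
          (.inl ⟨(s, u), ⟨hl s (by simp), trivial⟩, rfl⟩) fun h0 => hs ?_
        rw [map_mul, Equiv.Perm.mul_apply]
        conv_rhs => rw [← add_sub_cancel (p u) (act s (p u)), hact]
        rw [Finsupp.add_apply, h0, add_zero]
  -- A geodesic from `x` to `y` comes within `R` of `γ * c`; the detour there and back costs `2 *
  -- R`.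
  refine ⟨2 * R, fun γ x y u w h => ?_⟩
  obtain ⟨l, hl, hlS, hlp⟩ := exists_word hS.2 (x⁻¹ * y)
  obtain ⟨l₁, l₂, rfl, c, hc, hcR⟩ : ∃ l₁ l₂ : List (𝒢.FundamentalGroup T), l = l₁ ++ l₂ ∧
        ∃ c ∈ (𝒢.edgeHom T e true).range, wordDist S (x * l₁.prod) (γ * c) ≤ R := by
    -- If moving from `x` to `y` leaves the coordinate unchanged, the difference stems from
    -- replacing `p u` by `p w` at `y`.
    by_cases hu : act x (p u) (QuotientGroup.mk γ) = act y (p u) (QuotientGroup.mk γ)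
    · refine ⟨l, [], by simp, ?_⟩
      rw [hlp, mul_inv_cancel_left]
      refine hnear γ y (p w - p u) (.inr ⟨(w, u), rfl⟩) fun h0 => h ?_
      rw [hu]
      conv_rhs => rw [← add_sub_cancel (p u) (p w), hact]
      rw [Finsupp.add_apply, h0, add_zero]
    · exact hwalk γ u l x hlS (by rwa [hlp, mul_inv_cancel_left])
  refine ⟨c, hc, ?_⟩
  have h1 : wordDist S x (x * l₁.prod) ≤ l₁.length := by
    rw [wordDist_mul_right]
    exact_mod_cast wordLength_prod_le fun s hs => hlS s (by simp [hs])
  have h2 : wordDist S (x * l₁.prod) y ≤ l₂.length := by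
    have : y = x * l₁.prod * l₂.prod := by
      rw [mul_assoc, ← List.prod_append, hlp, mul_inv_cancel_left]
    rw [this, wordDist_mul_right]
    exact_mod_cast wordLength_prod_le fun s hs => hlS s (by simp [hs])
  have h3 : wordDist S x y = l₁.length + l₂.length := by
    rw [wordDist, ← hl, List.length_append, Nat.cast_add]
  have t1 := wordDist_triangle hS.2 x (x * l₁.prod) (γ * c)
  have t2 := wordDist_triangle hS.2 (γ * c) (x * l₁.prod) y
  have t3 := wordDist_comm hS.2 (γ * c) (x * l₁.prod)
  linarith

/-- The element that takes the coset of the neutral element to that of the edge `e`, seen from its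
end `b`. -/
def edgeTranslate (e : E) : Bool → 𝒢.FundamentalGroup T
  | true => 1
  | false => (𝒢.stableLetter T e)⁻¹

/-- The sign of an end of an edge. -/
def endSign : Bool → ℤ
  | true => 1
  | false => -1

theorem edgeHom_mul_edgeTranslate (e : E) (b : Bool) (g : 𝒢.edgeGroup e) :
    𝒢.edgeHom T e b g * 𝒢.edgeTranslate T e b =
      𝒢.edgeTranslate T e b * 𝒢.edgeHom T e true g := by
  cases b
  · exact 𝒢.edgeHom_mul_transit T e false g
  · simp [edgeTranslate]

/-- Conjugation by `edgeTranslate` matches the two images of the edge group, so coordinates indexed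
by cosets of the image at `true` can be read from either end. -/
theorem mk_mul_edgeTranslate_eq_iff (e : E) (b : Bool) (x y : 𝒢.FundamentalGroup T) :
    (QuotientGroup.mk (x * 𝒢.edgeTranslate T e b) :
      𝒢.FundamentalGroup T ⧸ (𝒢.edgeHom T e true).range) =
        QuotientGroup.mk (y * 𝒢.edgeTranslate T e b) ↔ x⁻¹ * y ∈ (𝒢.edgeHom T e b).range := by
  rw [QuotientGroup.eq]
  constructor
  · rintro ⟨g, hg⟩
    refine ⟨g, ?_⟩
    rw [← mul_left_inj (𝒢.edgeTranslate T e b), edgeHom_mul_edgeTranslate, hg]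
    group
  · rintro ⟨g, hg⟩
    refine ⟨g, ?_⟩
    rw [← mul_right_inj (𝒢.edgeTranslate T e b), ← edgeHom_mul_edgeTranslate, hg]
    group

/-! ### Effect of crossing an edge on the base points. -/

section Transit

variable {e : E} {act : 𝒢.FundamentalGroup T →* Equiv.Perm (𝒢.EdgeModule T e)}
  {p : V → 𝒢.EdgeModule T e}

theorem act_transit_of_ne {e' : E} (hstable : ∀ e', act (𝒢.stableLetter T e')
      (p (𝒢.endpoint e' false)) = p (𝒢.endpoint e' true) + defect e') (he : e' ≠ e) (b : Bool) :
    act (𝒢.transit T e' b) (p (𝒢.endpoint e' (!b))) = p (𝒢.endpoint e' b) := by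
  have h := hstable e'
  rw [defect, if_neg he, add_zero] at h
  cases b
  · simp only [transit, Bool.not_false]
    rw [map_inv, ← h, Equiv.Perm.inv_def, Equiv.symm_apply_apply]
  · exact h

/-- Crossing `e` changes a single coordinate, by a sign that depends on the direction. For `false`
the relation for the stable letter is solved by applying its inverse. -/
theorem act_transit_self (hact : ∀ g m m', act g (m + m') = act g m + lin g m')
    (hstable : ∀ e', act (𝒢.stableLetter T e')
      (p (𝒢.endpoint e' false)) = p (𝒢.endpoint e' true) + defect e') (b : Bool) :
    act (𝒢.transit T e b) (p (𝒢.endpoint e (!b))) = p (𝒢.endpoint e b) +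
      Finsupp.single (QuotientGroup.mk (𝒢.edgeTranslate T e b)) (endSign b) := by
  have h := hstable e
  rw [defect, if_pos rfl] at h
  cases b
  · simp only [transit, Bool.not_false, edgeTranslate, endSign]
    have h' := congrArg (act (𝒢.stableLetter T e)⁻¹) h
    rw [hact, map_inv, Equiv.Perm.inv_def, Equiv.symm_apply_apply, ← Equiv.Perm.inv_def, ← map_inv, origin, lin_single, mul_one] at h'
    rw [h', add_assoc, ← Finsupp.single_add]
    simp
  · exact h

end Transit

end GraphOfGroups

/-! ### Separation for a vertex group with three adjacent translates. -/

namespace GraphOfGroups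

variable {V : Type u₁} {E : Type u₂} (𝒢 : GraphOfGroups.{u₁, u₂, u₃, u₄} V E) (T : Set E)

open EdgeModule LatticePoint
open Multiplicative (ofAdd toAdd)

variable {𝒢 T} in
/-- A branched lattice formed by a vertex group and three adjacent translates of vertex groups is
separated. -/
theorem IsSpanningTree.separated [Finite V] (hT : 𝒢.IsSpanningTree T)
    {S : Set (𝒢.FundamentalGroup T)} (hS : IsFiniteGenerating S)
    (L : BranchedLattice (𝒢.FundamentalGroup T)) {v : V} {e : Fin 3 → E} {b : Fin 3 → Bool}
    (hφ : ∀ z, ∃ g, L.φ (ofAdd z) = 𝒢.vertexHom T v g)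
    (hψ : ∀ i z, ∃ g, L.ψ i (ofAdd z) = 𝒢.vertexHom T (𝒢.endpoint (e i) (!b i)) g)
    (hv : ∀ i, 𝒢.endpoint (e i) (b i) = v) (hτ : ∀ i, L.τ i = 𝒢.transit T (e i) (b i))
    (hinj : Function.Injective L.φ)
    (hrange : ∀ i, (𝒢.edgeHom T (e i) (b i)).range = Subgroup.zpowers (L.φ (ofAdd (L.h i))))
    (hpair : ∀ i j, e i = e j → b i = b j → i = j) : L.Separated S := by
  suffices h : ∀ i, ∃ R : ℝ, ∀ k r s y, BranchedLattice.OffWing i k y → ∃ n : ℤ,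
      L.groupDist S (wing i k r s) (flat (L.foot i k n)) +
        L.groupDist S (flat (L.foot i k n)) y ≤ L.groupDist S (wing i k r s) y + R by
    choose R hR using h
    obtain ⟨R', hR'⟩ := (Set.finite_range R).bddAbove
    refine ⟨R', fun i k r s y hy => ?_⟩
    obtain ⟨n, hn⟩ := hR i k r s y hy
    exact ⟨n, hn.trans (by linarith [hR' ⟨i, rfl⟩])⟩
  intro i
  obtain ⟨act, p, hact, hvert, hstable⟩ := hT.exists_affineAction 𝒢 (e i)
  obtain ⟨R, hR⟩ := 𝒢.exists_near_coset T hS act p hact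
  -- The whole base flat corresponds to one point of the module, and by `hwing` so does each wing.
  have hflat (z : ℤ × ℤ) : act (L.φ (ofAdd z)) (p v) = p v := by
    obtain ⟨g, hg⟩ := hφ z
    rw [hg, hvert]
  have hwing (j : Fin 3) (l r : ℤ) (s : ℕ) :
      act (L.toGroup (wing j l r s)) (p (𝒢.endpoint (e j) (!b j))) =
        act (L.φ (ofAdd (l • quarterTurn (L.h j))))
          (act (𝒢.transit T (e j) (b j)) (p (𝒢.endpoint (e j) (!b j)))) := by
    obtain ⟨g, hg⟩ := hψ j (L.sideVec j r s)
    rw [BranchedLattice.toGroup, hg, hτ, map_mul, map_mul, Equiv.Perm.mul_apply,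
      Equiv.Perm.mul_apply, hvert]
  have hother (j : Fin 3) (hj : e j ≠ e i) (l r : ℤ) (s : ℕ) :
      act (L.toGroup (wing j l r s)) (p (𝒢.endpoint (e j) (!b j))) = p v := by
    rw [hwing, 𝒢.act_transit_of_ne T hstable hj, hv, hflat]
  have hsame (j : Fin 3) (hj : e j = e i) (l r : ℤ) (s : ℕ) :
      act (L.toGroup (wing j l r s)) (p (𝒢.endpoint (e j) (!b j))) = p v +
        Finsupp.single (QuotientGroup.mk (L.φ (ofAdd (l • quarterTurn (L.h j))) *
          𝒢.edgeTranslate T (e i) (b j))) (endSign (b j)) := by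
    have hvj : 𝒢.endpoint (e i) (b j) = v := hj ▸ hv j
    rw [hwing, hj, 𝒢.act_transit_self T hact hstable, hact, lin_single, hvj, hflat]
  -- The nearby coset of the edge group is the attaching line multiplied on the right by `t`;
  -- removing `t` changes each of the two distances by at most its length.
  refine ⟨R + 2 * wordLength S (𝒢.edgeTranslate T (e i) (b i)), fun k r s y hy => ?_⟩
  set γ := L.φ (ofAdd (k • quarterTurn (L.h i))) with hγ
  set t := 𝒢.edgeTranslate T (e i) (b i) with ht
  have hx : act (L.toGroup (wing i k r s)) (p (𝒢.endpoint (e i) (!b i)))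
      (QuotientGroup.mk (γ * t)) = p v (QuotientGroup.mk (γ * t)) + endSign (b i) := by
    rw [hsame i rfl, Finsupp.add_apply, Finsupp.single_eq_same]
  have hsign : endSign (b i) ≠ 0 := by cases b i <;> decide
  obtain ⟨w, hw⟩ : ∃ w, act (L.toGroup (wing i k r s)) (p (𝒢.endpoint (e i) (!b i)))
      (QuotientGroup.mk (γ * t)) ≠ act (L.toGroup y) (p w) (QuotientGroup.mk (γ * t)) := by
    cases hy with
    | flat z =>
      refine ⟨v, ?_⟩
      rw [hx, BranchedLattice.toGroup, hflat]
      simpa using hsign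
    | wing j l r' s' hjl =>
      refine ⟨𝒢.endpoint (e j) (!b j), ?_⟩
      by_cases hj : e j = e i
      · rw [hx, hsame j hj, Finsupp.add_apply, Ne, add_right_inj]
        -- Wings over the same end sit over different cosets. Over opposite ends of a loop the
        -- coordinates change with opposite signs, so they differ even if the cosets agree.
        by_cases hb : b j = b i
        · obtain rfl := hpair j i hj hb
          have hne : (QuotientGroup.mk (γ * t) : _ ⧸ (𝒢.edgeHom T (e j) true).range) ≠
              QuotientGroup.mk (L.φ (ofAdd (l • quarterTurn (L.h j))) *
                𝒢.edgeTranslate T (e j) (b j)) := by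
            rw [Ne, 𝒢.mk_mul_edgeTranslate_eq_iff, hrange, hγ, ← map_inv, ← map_mul,
              ← MonoidHom.map_zpowers, Subgroup.mem_map_iff_mem hinj]
            rintro ⟨n, hn⟩
            have hn' : n • L.h j = (l - k) • quarterTurn (L.h j) := by
              have := congrArg toAdd hn
              simp only [toAdd_zpow, toAdd_mul, toAdd_inv, toAdd_ofAdd] at this
              rw [this, sub_smul]
              abel
            -- Independence of `h j` and its quarter turn forces `l = k`: distinct levels give
            -- distinct cosets.
            have hab := abs_add_abs_le_latticeNorm (L.h_ne_zero j) n (-(l - k))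
            rw [neg_smul, hn', add_neg_cancel] at hab
            have hlk : l - k = 0 := by
              have h1 : |((-(l - k) : ℤ) : ℝ)| ≤ 0 := by
                have := abs_nonneg (n : ℝ)
                simp only [latticeNorm, Prod.fst_zero, Prod.snd_zero, Int.cast_zero, abs_zero,
                  add_zero, mul_zero] at hab
                linarith
              have h2 := abs_eq_zero.1 (le_antisymm h1 (abs_nonneg _))
              have h3 : -(l - k) = 0 := by exact_mod_cast h2
              omega
            exact hjl (by rw [sub_eq_zero.1 hlk])
          rwa [Finsupp.single_eq_of_ne hne]
        · classical
          have hneg : endSign (b j) = -endSign (b i) := by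
            revert hb
            cases b j <;> cases b i <;> decide
          rw [hneg, Finsupp.single_apply]
          split_ifs <;> omega
      · rw [hx, hother j hj]
        simpa using hsign
  obtain ⟨_, ⟨c, rfl⟩, hc⟩ := hR (γ * t) _ _ _ _ hw
  obtain ⟨n, hn⟩ : 𝒢.edgeHom T (e i) (b i) c ∈ Subgroup.zpowers (L.φ (ofAdd (L.h i))) :=
    hrange i ▸ ⟨c, rfl⟩
  have hfoot : γ * t * 𝒢.edgeHom T (e i) true c = L.toGroup (flat (L.foot i k n)) * t := by
    rw [mul_assoc, ht, ← 𝒢.edgeHom_mul_edgeTranslate, ← hn, ← mul_assoc, BranchedLattice.toGroup,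
      BranchedLattice.foot, ofAdd_add, map_mul, ofAdd_zsmul n, map_zpow]
  refine ⟨n, ?_⟩
  rw [hfoot] at hc
  have h1 := wordDist_mul_right (S := S) (L.toGroup (flat (L.foot i k n))) t
  have h2 := wordDist_triangle hS.2 (L.toGroup (wing i k r s))
    (L.toGroup (flat (L.foot i k n)) * t) (L.toGroup (flat (L.foot i k n)))
  have h3 := wordDist_triangle hS.2 (L.toGroup (flat (L.foot i k n)))
    (L.toGroup (flat (L.foot i k n)) * t) (L.toGroup y)
  have h4 := wordDist_comm hS.2 (L.toGroup (flat (L.foot i k n)))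
    (L.toGroup (flat (L.foot i k n)) * t)
  simp only [BranchedLattice.groupDist]
  linarith

variable {𝒢} in
/-- An incident edge group in a tubular group is generated by the image of an element of the edge
group. -/
theorem IsIncidentEdgeGroup.exists_generator (h𝒢 : 𝒢.IsTubular) {v : V}
    {H : Subgroup (𝒢.vertexGroup v)} (hH : 𝒢.IsIncidentEdgeGroup v H) :
    ∃ (e : E) (b : Bool) (z : 𝒢.edgeGroup e) (x : 𝒢.vertexGroup v), 𝒢.endpoint e b = v ∧
      z ≠ 1 ∧ x ≠ 1 ∧ H = Subgroup.zpowers x ∧ 𝒢.vertexHom T v x = 𝒢.edgeHom T e b z ∧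
      H.map (𝒢.vertexHom T v) = (𝒢.edgeHom T e b).range := by
  cases hH with
  | range e b =>
    obtain ⟨f⟩ := h𝒢.edge e
    have hz : f.symm (ofAdd 1) ≠ 1 := by
      rw [Ne, EmbeddingLike.map_eq_one_iff]
      decide
    refine ⟨e, b, f.symm (ofAdd 1), 𝒢.incl e b (f.symm (ofAdd 1)), rfl, hz,
      fun h => hz (𝒢.incl_injective e b (h.trans (map_one _).symm)), ?_, rfl,
      (MonoidHom.range_comp _ _).symm⟩
    ext y
    constructor
    · rintro ⟨g, rfl⟩
      refine ⟨toAdd (f g), ?_⟩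
      change 𝒢.incl e b (f.symm (ofAdd 1)) ^ toAdd (f g) = _
      rw [← map_zpow, ← map_zpow, ← ofAdd_zsmul, smul_eq_mul, mul_one, ofAdd_toAdd,
        MulEquiv.symm_apply_apply]
    · rintro ⟨n, rfl⟩
      exact ⟨f.symm (ofAdd 1) ^ n, map_zpow _ _ _⟩

end GraphOfGroups

/-! ### The branched lattice at the given vertex. -/

theorem lemma6 {V : Type u₁} {E : Type u₂} [Finite V] [Finite E]
    (𝒢 : GraphOfGroups.{u₁, u₂, u₃, u₄} V E) (T : Set E) (hT : 𝒢.IsSpanningTree T)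
    (h𝒢 : 𝒢.IsTubular) (hund : 𝒢.IsUndistorted T)
    (v : V) (H : Fin 3 → Subgroup (𝒢.vertexGroup v))
    (hinc : ∀ i, 𝒢.IsIncidentEdgeGroup v (H i))
    (hcomm : Pairwise fun i j => ¬ Subgroup.Commensurable (H i) (H j)) :
    HasQIEmbeddedRBF 2 (𝒢.FundamentalGroup T) := by
  obtain ⟨-, S₀, -, hS₀, -⟩ := hund v
  have hFG : Group.FG (𝒢.FundamentalGroup T) :=
    Group.fg_iff.2 ⟨S₀, hS₀.2, hS₀.1⟩
  let f (u : V) : 𝒢.vertexGroup u ≃* Multiplicative (ℤ × ℤ) := (h𝒢.vertex u).some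
  let φ (u : V) : Multiplicative (ℤ × ℤ) →* 𝒢.FundamentalGroup T :=
    (𝒢.vertexHom T u).comp (f u).symm.toMonoidHom
  have hgrow {S : Set (𝒢.FundamentalGroup T)} (hS : IsFiniteGenerating S) (u : V) :
      GrowsLinearly S (φ u) := (hund u).growsLinearly (f u) hS
  have hφinj (u : V) : Function.Injective (φ u) := (hgrow hS₀ u).injective
  have hφf (u : V) (g : 𝒢.vertexGroup u) : φ u (f u g) = 𝒢.vertexHom T u g := by
    simp [φ]
  have hvinj : Function.Injective (𝒢.vertexHom T v) := fun g g' h =>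
    (f v).injective (hφinj v (by rw [hφf, hφf, h]))
  choose e b z x hv hz hx hHx hxz hrange using
    fun i => (hinc i).exists_generator T h𝒢
  have hne_one (u : V) (g : 𝒢.vertexGroup u) (hg : g ≠ 1) :
      Multiplicative.toAdd (f u g) ≠ 0 := fun h =>
    hg ((f u).injective ((toAdd_eq_zero.1 h).trans (map_one (f u)).symm))
  let L : BranchedLattice (𝒢.FundamentalGroup T) :=
    { φ := φ v
      ψ := fun i => φ (𝒢.endpoint (e i) (!b i))
      τ := fun i => 𝒢.transit T (e i) (b i)
      h := fun i => Multiplicative.toAdd (f v (x i))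
      h' := fun i => Multiplicative.toAdd (f _ (𝒢.incl (e i) (!b i) (z i)))
      -- Parallel generators in ℤ² have a common nonzero power, which would make the edge groups
      -- commensurable.
      indep := fun i j hij h => by
        obtain ⟨m, n, hm, hn, hmn⟩ := exists_zsmul_eq_zsmul (hne_one v _ (hx i))
          (hne_one v _ (hx j)) h
        refine hcomm hij ?_
        rw [hHx, hHx]
        refine Subgroup.commensurable_zpowers hm hn ((f v).injective ?_)
        rw [map_zpow, map_zpow]
        exact hmn
      h'_ne_zero := fun i => hne_one _ _ fun h =>
        hz i (𝒢.incl_injective _ _ (h.trans (map_one _).symm))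
      comm := fun i => by
        rw [ofAdd_toAdd, ofAdd_toAdd, hφf, hφf, hxz]
        exact 𝒢.edgeHom_mul_transit T (e i) (b i) (z i) }
  -- Equal ends of equal edges give equal, hence commensurable, subgroups. The two ends of one loop
  -- remain possible for different indices.
  have hpair (i j : Fin 3) (he : e i = e j) (hb : b i = b j) : i = j := by
    by_contra hij
    refine hcomm hij ?_
    have : H i = H j := by
      apply Subgroup.map_injective hvinj
      rw [hrange, hrange, he, hb]
    rw [this]
  refine ⟨hFG, L.rbf, fun y => L.toGroup (L.round y), fun S hS => ?_⟩
  refine L.isQIEmbedding hS.2 (hgrow hS v) (fun i => hgrow hS _) ?_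
  refine hT.separated hS L (fun z => ⟨_, rfl⟩) (fun i z => ⟨_, rfl⟩) hv (fun i => rfl) (hφinj v)
    (fun i => ?_) hpair
  rw [← hrange, hHx, MonoidHom.map_zpowers]
  congr 1
  exact (hφf v (x i)).symm
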